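/- All graphs are finite and simple. A set $X$ of vertices of a graph $G$ is dominating if every vertex of $G$ lies in $X$ or has a neighbour in $X$. The TARS-graph $\varepsilon(G)$ has the dominating sets of $G$ as its vertices; two dominating sets $X, Y$ are adjacent if and only if $Y$ is obtained from $X$ by adding or deleting a single vertex of $G$, or there are $u \in X$ and $v \in Y \setminus X$ that are adjacent in $G$ with $Y = (X \cup \{v\}) \setminus \{u\}$. A graph on $n$ vertices is pancyclic if it contains a cycle of length $\ell$ for every integer $\ell$ with $3 \le \ell \le n$. The join $G \vee H$ is the disjoint union of $G$ and $H$ together with all edges between $V(G)$ and $V(H)$. Theorem. Let $G$ and $H$ be graphs. If $\varepsilon(G)$ and $\varepsilon(H)$ are pancyclic, then $\varepsilon(G \vee H)$ is pancyclic. Consequently, $\varepsilon(G)$ is pancyclic whenever $G$ is a complete multipartite graph (the vertex set is partitioned into parts, and two vertices are adjacent if and only if they lie in different parts) and whenever $G$ is a complete split graph (the vertex set is partitioned into a clique $K$ and an independent set $I$, and every vertex of $K$ is adjacent to every vertex of $I$). -/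

import Mathlib

universe u v

namespace SimpleGraph

/-- `X` is a dominating set of `G`: every vertex lies in `X` or has a neighbour in `X`. -/
def IsDominatingSet {V : Type u} (G : SimpleGraph V) (X : Set V) : Prop :=
  ∀ w, w ∈ X ∨ ∃ x ∈ X, G.Adj x w

/-- Token addition/removal: `Y` is obtained from `X` by adding or deleting a single vertex. -/
def TARAdj {V : Type u} (X Y : Set V) : Prop :=
  (∃ w, w ∉ X ∧ Y = insert w X) ∨ (∃ w, w ∈ X ∧ Y = X \ {w})

/-- Token sliding: `Y` is obtained from `X` by exchanging `a ∈ X` for a neighbour `b` of `a`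
in `Y \ X`. -/
def TSAdj {V : Type u} (G : SimpleGraph V) (X Y : Set V) : Prop :=
  ∃ a ∈ X, ∃ b ∈ Y \ X, G.Adj a b ∧ Y = (X ∪ {b}) \ {a}

theorem TARAdj.symm {V : Type u} {X Y : Set V} (h : TARAdj X Y) : TARAdj Y X := by
  rcases h with ⟨w, hw, rfl⟩ | ⟨w, hw, rfl⟩
  · refine Or.inr ⟨w, Set.mem_insert _ _, ?_⟩
    ext z; simp only [Set.mem_sdiff, Set.mem_insert_iff, Set.mem_singleton_iff]; grind
  · refine Or.inl ⟨w, by simp, ?_⟩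
    ext z; simp only [Set.mem_sdiff, Set.mem_insert_iff, Set.mem_singleton_iff]; grind

theorem TSAdj.symm {V : Type u} {G : SimpleGraph V} {X Y : Set V} (h : TSAdj G X Y) :
    TSAdj G Y X := by
  obtain ⟨a, ha, b, ⟨hbY, hbX⟩, hab, hY⟩ := h
  have hne : a ≠ b := hab.ne
  refine ⟨b, hbY, a, ⟨ha, by rw [hY]; simp⟩, hab.symm, ?_⟩
  rw [hY]; ext z
  simp only [Set.mem_sdiff, Set.mem_union, Set.mem_singleton_iff]; grind

/-- The TARS-graph of `G`: its vertices are the dominating sets of `G`, and two of them are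
adjacent if they are related by token addition/removal or by token sliding. -/
def tarsGraph {V : Type u} (G : SimpleGraph V) :
    SimpleGraph {X : Set V // G.IsDominatingSet X} where
  Adj X Y := TARAdj X.1 Y.1 ∨ TSAdj G X.1 Y.1
  symm := ⟨fun _ _ h => h.imp TARAdj.symm TSAdj.symm⟩
  loopless := ⟨by
    rintro ⟨X, _⟩ ((⟨w, hw, h⟩ | ⟨w, hw, h⟩) | ⟨a, _, b, ⟨hb, hb'⟩, _⟩)
    · have h : X = insert w X := h
      exact hw (h.symm.subset (Set.mem_insert w X))
    · have h : X = X \ {w} := h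
      exact (h.subset hw).2 rfl
    · exact hb' hb⟩

/-- A finite graph on `n` vertices is pancyclic if it has a cycle of every length `ℓ` with
`3 ≤ ℓ ≤ n`. -/
def IsPancyclic {V : Type u} [Finite V] (G : SimpleGraph V) : Prop :=
  ∀ ℓ : ℕ, 3 ≤ ℓ → ℓ ≤ Nat.card V → ∃ (x : V) (p : G.Walk x x), p.IsCycle ∧ p.length = ℓ

/-- The join of `G` and `H`: their disjoint union together with all edges between them. -/
def join {V : Type u} {W : Type v} (G : SimpleGraph V) (H : SimpleGraph W) :
    SimpleGraph (V ⊕ W) :=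
  (G ⊕g H) ⊔ completeBipartiteGraph V W

/-- A complete split graph: the vertex set is partitioned into a clique `K` and an independent
set, with every vertex of `K` adjacent to every vertex of the independent set. -/
def IsCompleteSplit {V : Type u} (G : SimpleGraph V) : Prop :=
  ∃ K : Set V, G.IsClique K ∧ G.IsIndepSet Kᶜ ∧ ∀ x ∈ K, ∀ y ∉ K, G.Adj x y

end SimpleGraph

/-!
A dominating set of a join `G ∨ H` is a pair `(X, Y)` of nonempty sets, a dominating set of `G`
paired with `∅`, or `∅` paired with a dominating set of `H`. Gray codes arrange the pairs of
nonempty sets in a grid. Since a token can slide between the two sides of the join, every square of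
the grid has a diagonal, so paths along the grid can be lengthened one vertex at a time. A
Hamiltonian cycle of `ε(G)` contains an edge between `univ` and some `univ \ {a}`; the dominating
sets of `G`, run through along the rest of the cycle, form a detour that replaces the edge between
`(univ, Y)` and `(univ \ {a}, Y)` for a singleton `Y`. Switching these detours on or off for each
of the two sides yields the remaining lengths. If `H` has a single vertex, the nonempty sets on its
side leave no grid but only a bipartite cube; there a detour shorter by one vertex provides the
other parity.

Complete multipartite and complete split graphs are iterated joins of edgeless graphs.
-/

namespace TARS

open Set SimpleGraph
open scoped symmDiff

section FlexPath

variable {α β : Type*} {Γ : SimpleGraph α} {a b c d : α} {m m' m₁ m₂ m₃ : ℕ}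
  {s s₁ s₂ s₃ : Multiset α}

/-- The graph contains a cycle of length `k`. -/
def HasCycle (Γ : SimpleGraph α) (k : ℕ) : Prop :=
  ∃ (x : α) (p : Γ.Walk x x), p.IsCycle ∧ p.length = k

/-- For every `k` between `m` and the cardinality of `s`, the graph has a path from `a` to `b`
with exactly `k` interior vertices, all of them taken from `s`. A path is a list without any
condition on repetitions: these follow once `a ::ₘ b ::ₘ s` is known to be duplicate-free. -/
def FlexPath (Γ : SimpleGraph α) (a b : α) (m : ℕ) (s : Multiset α) : Prop :=
  m ≤ s.card ∧ ∀ k, m ≤ k → k ≤ s.card →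
    ∃ l : List α, ↑l ≤ s ∧ l.length = k ∧ (a :: (l ++ [b])).IsChain Γ.Adj

theorem FlexPath.of_isChain {l : List α} (h : (a :: (l ++ [b])).IsChain Γ.Adj) :
    FlexPath Γ a b l.length l :=
  ⟨le_rfl, fun _ hk hk' => ⟨l, le_rfl, le_antisymm hk hk', h⟩⟩

theorem FlexPath.of_adj (h : Γ.Adj a b) : FlexPath Γ a b 0 0 :=
  of_isChain (l := []) (by simpa using h)

theorem FlexPath.adj (h : FlexPath Γ a b 0 s) : Γ.Adj a b := by
  obtain ⟨l, -, hl, hc⟩ := h.2 0 le_rfl (Nat.zero_le _)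
  simpa [List.length_eq_zero_iff.1 hl] using hc

theorem FlexPath.mono (h : FlexPath Γ a b m s) (hm : m ≤ m') (hs : m' ≤ s.card) :
    FlexPath Γ a b m' s :=
  ⟨hs, fun k hk => h.2 k (hm.trans hk)⟩

theorem FlexPath.symm (h : FlexPath Γ a b m s) : FlexPath Γ b a m s := by
  refine ⟨h.1, fun k hk hk' => ?_⟩
  obtain ⟨l, hls, hl, hc⟩ := h.2 k hk hk'
  refine ⟨l.reverse, by simpa using hls, by simpa using hl, ?_⟩
  have := List.isChain_reverse.2 (hc.imp fun _ _ h => h.symm)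
  simpa [flip] using this

theorem FlexPath.trans (h₁ : FlexPath Γ a c m₁ s₁) (h₂ : FlexPath Γ c b m₂ s₂) :
    FlexPath Γ a b (m₁ + m₂ + 1) (c ::ₘ (s₁ + s₂)) := by
  have hcard : (c ::ₘ (s₁ + s₂)).card = s₁.card + s₂.card + 1 := by simp
  have := h₁.1
  have := h₂.1
  refine ⟨by omega, fun k hk hk' => ?_⟩
  obtain ⟨k₁, k₂, rfl, _, _, _, _⟩ : ∃ k₁ k₂, k = k₁ + k₂ + 1 ∧ m₁ ≤ k₁ ∧ k₁ ≤ s₁.card ∧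
      m₂ ≤ k₂ ∧ k₂ ≤ s₂.card :=
    ⟨min s₁.card (k - m₂ - 1), k - 1 - min s₁.card (k - m₂ - 1), by omega, by omega, by omega,
      by omega, by omega⟩
  obtain ⟨l₁, hls₁, hl₁, hc₁⟩ := h₁.2 k₁ ‹_› ‹_›
  obtain ⟨l₂, hls₂, hl₂, hc₂⟩ := h₂.2 k₂ ‹_› ‹_›
  refine ⟨l₁ ++ c :: l₂, ?_, by simp [hl₁, hl₂, add_assoc], ?_⟩
  · rw [← Multiset.coe_add, ← Multiset.cons_coe, Multiset.add_cons]
    exact Multiset.cons_le_cons c (add_le_add hls₁ hls₂)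
  · have := hc₁.append_overlap (l₁ := a :: l₁) (l₂ := [c]) (l₃ := l₂ ++ [b]) hc₂ (by simp)
    simpa using this

theorem FlexPath.cons_of_adj (h : FlexPath Γ a b m s) (hac : Γ.Adj a c)
    (hcb : FlexPath Γ c b m s) : FlexPath Γ a b m (c ::ₘ s) := by
  have hle := h.1
  refine ⟨hle.trans (Multiset.card_le_card (Multiset.le_cons_self s c)), fun k hk hk' => ?_⟩
  rw [Multiset.card_cons] at hk'
  obtain hks | hks : k ≤ s.card ∨ k = s.card + 1 := by omega
  · obtain ⟨l, hls, hl⟩ := h.2 k hk hks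
    exact ⟨l, hls.trans (Multiset.le_cons_self s c), hl⟩
  · obtain ⟨l, hls, hl, hc⟩ := hcb.2 s.card hle le_rfl
    refine ⟨c :: l, Multiset.cons_le_cons c hls, by rw [List.length_cons, hl, hks], ?_⟩
    exact List.isChain_cons_cons.2 ⟨hac, hc⟩

theorem FlexPath.triangle (hab : Γ.Adj a b) (hac : Γ.Adj a c) (hcb : Γ.Adj c b) :
    FlexPath Γ a b 0 {c} :=
  (FlexPath.of_adj hab).cons_of_adj hac (.of_adj hcb)

/-- The least number of interior vertices of a path past a detour with at least `m` vertices which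
costs `j` further ones. If `m = 0`, the detour and its cost can be avoided. -/
def pad (m j : ℕ) : ℕ := if m = 0 then 0 else m + j

theorem pad_of_ne_zero {j : ℕ} (hm : m ≠ 0) : pad m j = m + j := if_neg hm

theorem pad_le (m j : ℕ) : pad m j ≤ m + j := by
  unfold pad; split_ifs <;> omega

/-- The diagonal provides the paths with a single interior vertex. -/
theorem FlexPath.square (hab : Γ.Adj a b) (h₁ : FlexPath Γ a c m₁ s₁) (h₂ : FlexPath Γ c d m₂ s₂)
    (h₃ : FlexPath Γ d b m₃ s₃) (hdiag : Γ.Adj a d ∨ Γ.Adj c b) :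
    FlexPath Γ a b (pad (m₁ + m₂ + m₃) 2)
      (c ::ₘ d ::ₘ (s₁ + s₂ + s₃)) := by
  have long : FlexPath Γ a b (m₁ + m₂ + m₃ + 2) (c ::ₘ d ::ₘ (s₁ + s₂ + s₃)) := by
    have := (h₁.trans h₂).trans h₃
    rwa [Multiset.cons_add, Multiset.cons_swap, show m₁ + m₂ + 1 + m₃ + 1 = m₁ + m₂ + m₃ + 2 by
      omega] at this
  by_cases h0 : m₁ + m₂ + m₃ = 0
  swap; · rwa [pad_of_ne_zero h0]
  obtain ⟨rfl, rfl, rfl⟩ : m₁ = 0 ∧ m₂ = 0 ∧ m₃ = 0 := by omega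
  refine ⟨Nat.zero_le _, fun k _ hk => ?_⟩
  obtain rfl | rfl | hk2 : k = 0 ∨ k = 1 ∨ 2 ≤ k := by omega
  · exact ⟨[], by simp, rfl, by simpa using hab⟩
  · rcases hdiag with had | hcb
    · exact ⟨[d], by simp, rfl, by simp [had, h₃.adj]⟩
    · exact ⟨[c], by simp, rfl, by simp [hcb, h₁.adj]⟩
  · exact long.2 k hk2 hk

theorem FlexPath.hasCycle {S : Set α} (h : FlexPath Γ a a m s) (hnd : (a ::ₘ s).Nodup)
    (hS : ∀ x ∈ a ::ₘ s, x ∈ S) {k : ℕ} (hmk : m < k) (hks : k ≤ s.card + 1) (hk : 3 ≤ k) :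
    HasCycle (Γ.induce S) k := by
  obtain ⟨l, hls, hl, hc⟩ := h.2 (k - 1) (by omega) (by omega)
  have hle : ((l ++ [a] : List α) : Multiset α) ≤ a ::ₘ s := by
    rw [← Multiset.coe_add, Multiset.coe_singleton, add_comm, Multiset.singleton_add]
    exact Multiset.cons_le_cons a hls
  obtain ⟨p, hp⟩ : ∃ p : Γ.Walk a a, p.support = a :: (l ++ [a]) :=
    ⟨(Walk.ofSupport _ (List.cons_ne_nil _ _) hc).copy (List.head_cons ..) (by simp), by
      rw [Walk.support_copy, Walk.support_ofSupport]⟩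
  have hlen : p.length = k := by
    have := congrArg List.length hp
    simp only [Walk.length_support, List.length_cons, List.length_append, hl,
      List.length_nil] at this
    omega
  have hcyc : p.IsCycle := by
    refine Walk.isCycle_iff_isPath_tail_and_le_length.2 ⟨?_, by rwa [hlen]⟩
    rw [Walk.isPath_def, Walk.support_tail_of_not_nil, hp, List.tail_cons]
    · exact_mod_cast Multiset.nodup_of_le hle hnd
    · rw [← Walk.length_eq_zero_iff]
      omega
  have hmem : ∀ x ∈ p.support, x ∈ S := fun x hx => by
    rw [hp] at hx
    obtain rfl | hx := List.mem_cons.1 hx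
    · exact hS _ (Multiset.mem_cons_self _ _)
    · exact hS x (Multiset.subset_of_le hle (by exact_mod_cast hx))
  refine ⟨_, p.induce S hmem, ?_, ?_⟩
  · rwa [← Walk.isCycle_map_iff_of_injective (f := (Embedding.induce S).toHom)
      Subtype.val_injective, Walk.map_induce]
  · rw [← Walk.length_map (Embedding.induce S).toHom, Walk.map_induce]
    exact hlen

/-- A step of a ladder with sides `f` and `g`: the square between the rungs `{f y, g y}` and
`{f z, g z}`, at least one of whose diagonals is present. The rung at `y` belongs to the previous
step. -/
structure LadderStep (Γ : SimpleGraph α) (f g : β → α) (y z : β) : Prop where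
  left : Γ.Adj (f y) (f z)
  right : Γ.Adj (g y) (g z)
  rung : Γ.Adj (f z) (g z)
  diag : Γ.Adj (f y) (g z) ∨ Γ.Adj (f z) (g y)

/-- The list of the components of the pairs of a list. -/
def flattenPairs (ps : List (β × β)) : List β := ps.flatMap fun p => [p.1, p.2]

@[simp] theorem flattenPairs_nil : flattenPairs ([] : List (β × β)) = [] := rfl

@[simp] theorem flattenPairs_cons (p : β × β) (ps : List (β × β)) :
    flattenPairs (p :: ps) = p.1 :: p.2 :: flattenPairs ps := rfl

/-- The vertices of the rungs of a ladder indexed by the components of the pairs in `ps`, together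
with the detours `s p` and `t p` attached to its two sides. -/
def ladderVertices (f g : β → α) (ps : List (β × β)) (s t : β × β → Multiset α) : Multiset α :=
  (flattenPairs ps : Multiset β).map f + (flattenPairs ps : Multiset β).map g +
    ((ps.map s).sum + (ps.map t).sum)

theorem ladderVertices_cons {f g : β → α} {p : β × β} {ps : List (β × β)}
    {s t : β × β → Multiset α} :
    ladderVertices f g (p :: ps) s t =
      f p.1 ::ₘ g p.1 ::ₘ f p.2 ::ₘ g p.2 ::ₘ (s p + ladderVertices f g ps s t + t p) := by
  simp only [ladderVertices, flattenPairs_cons, ← Multiset.cons_coe, ← Multiset.singleton_add,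
    Multiset.map_add, Multiset.map_singleton, List.map_cons, List.sum_cons]
  abel

theorem length_flattenPairs (ps : List (β × β)) : (flattenPairs ps).length = 2 * ps.length := by
  induction ps with
  | nil => rfl
  | cons p ps ih => simp [ih, mul_add]

theorem sum_map_le_card_sum_map {ps : List β} {w : β → ℕ} {s : β → Multiset α}
    (h : ∀ p ∈ ps, w p ≤ (s p).card) : (ps.map w).sum ≤ (ps.map s).sum.card := by
  induction ps with
  | nil => simp
  | cons p ps ih =>
    simp only [List.mem_cons, forall_eq_or_imp] at h
    simpa using add_le_add h.1 (ih h.2)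

theorem le_card_ladderVertices {f g : β → α} {ps : List (β × β)} {w : β × β → ℕ}
    {s t : β × β → Multiset α} (h : ∀ p ∈ ps, w p ≤ (s p).card) :
    (ps.map w).sum + 4 * ps.length ≤ (ladderVertices f g ps s t).card := by
  have := sum_map_le_card_sum_map h
  simp only [ladderVertices, Multiset.card_add, Multiset.card_map, Multiset.coe_card,
    length_flattenPairs]
  omega

/-- A path from one side of a ladder to the other goes up and down the ladder. It uses the detours
on its way and shortcuts through the diagonals otherwise. -/
theorem FlexPath.ladder {f g : β → α} {w : β × β → ℕ} {s t : β × β → Multiset α}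
    (ps : List (β × β)) (y : β) (hy : Γ.Adj (f y) (g y))
    (hps : (y :: flattenPairs ps).IsChain (LadderStep Γ f g))
    (hs : ∀ p ∈ ps, FlexPath Γ (f p.1) (f p.2) (w p) (s p))
    (ht : ∀ p ∈ ps, FlexPath Γ (g p.1) (g p.2) 0 (t p)) :
    FlexPath Γ (f y) (g y) (pad (ps.map w).sum (4 * ps.length)) (ladderVertices f g ps s t) := by
  induction ps generalizing y with
  | nil => simpa [pad, ladderVertices] using FlexPath.of_adj hy
  | cons p ps ih =>
    have hcard := le_card_ladderVertices (f := f) (g := g) (t := t) fun p hp => (hs p hp).1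
    simp only [flattenPairs_cons, List.isChain_cons_cons] at hps
    obtain ⟨h₁, h₂, hps⟩ := hps
    simp only [List.mem_cons, forall_eq_or_imp] at hs ht
    have inner := FlexPath.square h₁.rung hs.1 (ih p.2 h₂.rung hps hs.2 ht.2) ht.1.symm h₂.diag
    have outer := FlexPath.square hy (.of_adj h₁.left) inner (.of_adj h₁.right.symm) h₁.diag
    simp only [Multiset.zero_add, add_zero, ← ladderVertices_cons] at outer
    refine outer.mono ?_ ((pad_le _ _).trans hcard)
    simp only [pad, List.map_cons, List.sum_cons, List.length_cons]
    grind

end FlexPath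

section GrayCode

variable {V : Type*} {a w : V} {X Y Z : Set V} {l : List V} {L : List (Set V)}

theorem toggle_of_notMem (h : w ∉ X) : {w} ∆ X = insert w X := by
  rw [Set.symmDiff_def]
  grind

theorem toggle_of_mem (h : w ∈ X) : {w} ∆ X = X \ {w} := by
  rw [Set.symmDiff_def]
  grind

theorem mem_toggle_self : w ∈ {w} ∆ X ↔ w ∉ X := by
  simp [Set.mem_symmDiff]

theorem tarAdj_iff_exists_toggle : TARAdj X Y ↔ ∃ w, Y = {w} ∆ X := by
  constructor
  · rintro (⟨w, hw, rfl⟩ | ⟨w, hw, rfl⟩)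
    · exact ⟨w, (toggle_of_notMem hw).symm⟩
    · exact ⟨w, (toggle_of_mem hw).symm⟩
  · rintro ⟨w, rfl⟩
    by_cases hw : w ∈ X
    · exact Or.inr ⟨w, hw, toggle_of_mem hw⟩
    · exact Or.inl ⟨w, hw, toggle_of_notMem hw⟩

theorem tarAdj_toggle (w : V) (X : Set V) : TARAdj X ({w} ∆ X) :=
  tarAdj_iff_exists_toggle.2 ⟨w, rfl⟩

theorem tarAdj_symmDiff (Z : Set V) (h : TARAdj X Y) : TARAdj (Z ∆ X) (Z ∆ Y) := by
  obtain ⟨w, rfl⟩ := tarAdj_iff_exists_toggle.1 h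
  exact tarAdj_iff_exists_toggle.2 ⟨w, symmDiff_left_comm Z {w} X⟩

theorem isChain_map_symmDiff (Z : Set V) (h : L.IsChain TARAdj) :
    (L.map (Z ∆ ·)).IsChain TARAdj :=
  (List.isChain_map _).2 (h.imp fun _ _ => tarAdj_symmDiff Z)

/-- The reflection step of the reflected Gray code. -/
def reflect (w : V) (L : List (Set V)) : List (Set V) := L ++ L.reverse.map ({w} ∆ ·)

theorem isChain_reflect (w : V) (h : L.IsChain TARAdj) : (reflect w L).IsChain TARAdj := by
  refine h.append (isChain_map_symmDiff _ ?_) ?_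
  · exact List.isChain_reverse.2 (h.imp fun _ _ => TARAdj.symm)
  · intro X hX Y hY
    obtain rfl : Y = {w} ∆ X := by
      simp only [List.head?_map, List.head?_reverse, Option.mem_def] at hX hY
      simpa [hX, eq_comm] using hY
    exact tarAdj_toggle w X

theorem nodup_reflect (h : L.Nodup) (hw : ∀ X ∈ L, w ∉ X) : (reflect w L).Nodup := by
  refine h.append ((List.nodup_reverse.2 h).map (symmDiff_right_injective _)) ?_
  intro X hX hX'
  obtain ⟨Y, hY, rfl⟩ := List.mem_map.1 hX'
  exact hw _ hX (mem_toggle_self.2 (hw Y (List.mem_reverse.1 hY)))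

/-- The reflected Gray code: a list of all sets of elements of `l`. -/
def grayCode : List V → List (Set V)
  | [] => [∅]
  | w :: l => reflect w (grayCode l)

theorem isChain_grayCode (l : List V) : (grayCode l).IsChain TARAdj := by
  induction l with
  | nil => exact List.isChain_singleton _
  | cons w l ih => exact isChain_reflect w ih

theorem mem_grayCode : X ∈ grayCode l ↔ ∀ x ∈ X, x ∈ l := by
  induction l generalizing X with
  | nil => simp [grayCode, eq_empty_iff_forall_notMem]
  | cons w l ih =>
    have mem_image : X ∈ (grayCode l).map ({w} ∆ ·) ↔ {w} ∆ X ∈ grayCode l := by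
      rw [List.mem_map]
      exact ⟨by rintro ⟨Y, hY, rfl⟩; simpa, fun h => ⟨_, h, symmDiff_symmDiff_cancel_left _ _⟩⟩
    rw [grayCode, reflect, List.mem_append, List.map_reverse, List.mem_reverse, mem_image, ih, ih]
    simp only [Set.mem_symmDiff, Set.mem_singleton_iff, List.mem_cons]
    grind

theorem nodup_grayCode (h : l.Nodup) : (grayCode l).Nodup := by
  induction l with
  | nil => exact List.nodup_singleton _
  | cons w l ih =>
    rw [List.nodup_cons] at h
    exact nodup_reflect (ih h.2) fun X hX hw => h.1 (mem_grayCode.1 hX w hw)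

theorem head?_grayCode (l : List V) : (grayCode l).head? = some ∅ := by
  induction l with
  | nil => rfl
  | cons w l ih => simp [grayCode, reflect, List.head?_append, ih]

theorem length_grayCode (l : List V) : (grayCode l).length = 2 ^ l.length := by
  induction l with
  | nil => rfl
  | cons w l ih => simp [grayCode, reflect, ih, pow_succ, mul_two]

/-- If `L` lists sets not containing `a`, then `zigzag a L` pairs each of them with the set obtained
by adding `a`, in such an order that consecutive sets remain adjacent. -/
def zigzag (a : V) : List (Set V) → List (Set V × Set V)
  | [] => []
  | [X] => [({a} ∆ X, X)]
  | X :: Y :: L => ({a} ∆ X, X) :: (Y, {a} ∆ Y) :: zigzag a L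

theorem isChain_zigzag (a : V) : ∀ (X : Set V) (L : List (Set V)), (X :: L).IsChain TARAdj →
    ({a} ∆ X :: flattenPairs (zigzag a L)).IsChain TARAdj
  | X, [], _ => List.isChain_singleton _
  | X, [Y], h => by
    simp only [List.isChain_cons_cons] at h
    simpa [zigzag] using ⟨tarAdj_symmDiff {a} h.1, (tarAdj_toggle a Y).symm⟩
  | X, Y :: Z :: L, h => by
    simp only [List.isChain_cons_cons] at h
    simp only [zigzag, flattenPairs_cons, List.isChain_cons_cons]
    exact ⟨tarAdj_symmDiff {a} h.1, (tarAdj_toggle a Y).symm, h.2.1, tarAdj_toggle a Z,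
      isChain_zigzag a Z L h.2.2⟩

theorem flattenPairs_zigzag_perm (a : V) :
    ∀ L : List (Set V), (flattenPairs (zigzag a L)).Perm (L ++ L.map ({a} ∆ ·))
  | [] => .nil
  | [X] => .swap _ _ _
  | X :: Y :: L => by
    have := flattenPairs_zigzag_perm a L
    rw [← Multiset.coe_eq_coe] at this ⊢
    simp only [zigzag, flattenPairs_cons, List.map_cons, List.cons_append, ← Multiset.cons_coe,
      this, ← Multiset.coe_add, ← Multiset.singleton_add]
    abel

theorem mem_zigzag (a : V) : ∀ L : List (Set V), X ∈ L →
    ({a} ∆ X, X) ∈ zigzag a L ∨ (X, {a} ∆ X) ∈ zigzag a L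
  | [Y], h => by simp_all [zigzag]
  | Y :: Z :: L, h => by
    have ih := mem_zigzag a L
    simp only [List.mem_cons] at h
    simp only [zigzag, List.mem_cons]
    grind

/-- `{a}` followed by the components of the pairs in `ps` is a Gray code of the nonempty sets in
which `univ` and `univ \ {a}` are paired with each other. -/
structure IsSetEnumeration (a : V) (ps : List (Set V × Set V)) : Prop where
  isChain : ({a} :: flattenPairs ps).IsChain TARAdj
  nodup : ({a} :: flattenPairs ps).Nodup
  mem_iff : ∀ X, X ∈ {a} :: flattenPairs ps ↔ X.Nonempty
  univ_mem : (univ, univ \ {a}) ∈ ps ∨ (univ \ {a}, univ) ∈ ps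

theorem zigzag_perm_grayCode (a : V) (hL : grayCode l = ∅ :: L) :
    (∅ :: {a} :: flattenPairs (zigzag a L)).Perm (grayCode (a :: l)) := by
  have hzigzag := Multiset.coe_eq_coe.2 (flattenPairs_zigzag_perm a L)
  have hempty : {a} ∆ ∅ = ({a} : Set V) := symmDiff_bot {a}
  rw [grayCode, reflect, hL, ← Multiset.coe_eq_coe, ← Multiset.coe_add, List.map_reverse,
    Multiset.coe_reverse]
  simp only [List.map_cons, ← Multiset.cons_coe, hzigzag, hempty, ← Multiset.coe_add,
    ← Multiset.singleton_add]
  abel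

theorem isSetEnumeration_zigzag [Nontrivial V] (hnd : (a :: l).Nodup) (hl : ∀ x, x ∈ a :: l)
    (hL : grayCode l = ∅ :: L) : IsSetEnumeration a (zigzag a L) := by
  have hperm := zigzag_perm_grayCode a hL
  have hempty : {a} ∆ ∅ = ({a} : Set V) := symmDiff_bot {a}
  have hnodup := hperm.nodup_iff.2 (nodup_grayCode hnd)
  rw [List.nodup_cons] at hnodup
  refine ⟨hempty ▸ isChain_zigzag a ∅ L (hL ▸ isChain_grayCode l), hnodup.2, fun X => ?_, ?_⟩
  · have hmem := hperm.mem_iff.2 (mem_grayCode.2 fun x (_ : x ∈ X) => hl x)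
    rw [List.mem_cons] at hmem
    rw [nonempty_iff_ne_empty]
    exact ⟨fun h => ne_of_mem_of_not_mem h hnodup.1, hmem.resolve_left⟩
  · have hmem : univ \ {a} ∈ L := by
      have : univ \ {a} ∈ grayCode l :=
        mem_grayCode.2 fun x hx => (List.mem_cons.1 (hl x)).resolve_left hx.2
      refine (List.mem_cons.1 (hL ▸ this)).resolve_left ?_
      obtain ⟨c, hc⟩ := exists_ne a
      exact Set.Nonempty.ne_empty ⟨c, trivial, hc⟩
    have huniv : {a} ∆ (univ \ {a}) = univ := by
      rw [toggle_of_notMem (by simp), insert_sdiff_singleton, insert_eq_of_mem (mem_univ a)]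
    simpa only [huniv] using mem_zigzag a L hmem

theorem exists_grayCode_eq_cons [Finite V] (a : V) : ∃ l L, (a :: l).Nodup ∧ (∀ x, x ∈ a :: l) ∧
    grayCode l = ∅ :: L ∧ (∅ :: L).IsChain TARAdj ∧ L.length + 1 = 2 ^ (Nat.card V - 1) := by
  classical
  have := Fintype.ofFinite V
  have hperm := List.perm_cons_erase (Finset.mem_toList.2 (Finset.mem_univ a))
  set l := Finset.univ.toList.erase a
  obtain ⟨L, hL⟩ := List.head?_eq_some_iff.1 (head?_grayCode l)
  have hlength : l.length + 1 = Nat.card V := by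
    rw [← List.length_cons, ← hperm.length_eq, Finset.length_toList, Finset.card_univ,
      Nat.card_eq_fintype_card]
  refine ⟨l, L, hperm.nodup (Finset.nodup_toList _),
    fun x => hperm.subset (Finset.mem_toList.2 (Finset.mem_univ x)), hL,
    hL ▸ isChain_grayCode l, ?_⟩
  rw [← List.length_cons (a := ∅), ← hL, length_grayCode, ← hlength, Nat.add_sub_cancel]

theorem IsSetEnumeration.exists_cons_insert [Finite V] [Nontrivial V] (a : V) :
    ∃ c ps, c ≠ a ∧ IsSetEnumeration a ((insert c {a}, {c}) :: ps) := by
  obtain ⟨l, L, hnd, hl, hL, hchain, hlength⟩ := exists_grayCode_eq_cons a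
  have := Nat.one_lt_two_pow (Nat.sub_ne_zero_of_lt (Finite.one_lt_card (α := V)))
  obtain ⟨X, L, rfl⟩ := List.exists_cons_of_length_pos (l := L) (by omega)
  obtain ⟨c, hX⟩ := tarAdj_iff_exists_toggle.1 (List.isChain_cons_cons.1 hchain).1
  obtain rfl : X = {c} := hX.trans (symmDiff_bot _)
  have hc : c ∈ l := mem_grayCode.1 (by simp [hL]) c (mem_singleton c)
  have hca : c ≠ a := ne_of_mem_of_not_mem hc (List.nodup_cons.1 hnd).1
  have henum := isSetEnumeration_zigzag hnd hl hL
  have hpair : {a} ∆ {c} = (insert c {a} : Set V) := by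
    rw [toggle_of_notMem (by simpa using hca.symm), pair_comm]
  cases L <;> rw [zigzag, hpair] at henum <;> exact ⟨c, _, hca, henum⟩

theorem IsSetEnumeration.exists_cons_cons_insert [Finite V] (hV : 3 ≤ Nat.card V) (b : V) :
    ∃ p U ps, b ∉ U ∧ IsSetEnumeration b (p :: (U, insert b U) :: ps) := by
  have : Nontrivial V := Finite.one_lt_card_iff_nontrivial.1 (by omega)
  obtain ⟨l, L, hnd, hl, hL, -, hlength⟩ := exists_grayCode_eq_cons b
  have := Nat.pow_le_pow_right two_pos (Nat.sub_le_sub_right hV 1)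
  obtain ⟨X, L, rfl⟩ := List.exists_cons_of_length_pos (l := L) (by omega)
  rw [List.length_cons] at hlength
  obtain ⟨U, L, rfl⟩ := List.exists_cons_of_length_pos (l := L) (by omega)
  have hU : b ∉ U := fun h => (List.nodup_cons.1 hnd).1 <|
    mem_grayCode.1 (by simp [hL]) b h
  have henum := isSetEnumeration_zigzag hnd hl hL
  rw [zigzag, toggle_of_notMem hU] at henum
  exact ⟨_, U, _, hU, henum⟩

theorem rel_of_mem_of_isChain_flattenPairs {α : Type*} {R : α → α → Prop} {y : α}
    {ps : List (α × α)} (h : (y :: flattenPairs ps).IsChain R) {p : α × α} (hp : p ∈ ps) :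
    R p.1 p.2 := by
  induction ps generalizing y with
  | nil => cases hp
  | cons q ps ih =>
    simp only [flattenPairs_cons, List.isChain_cons_cons] at h
    obtain rfl | hp := List.mem_cons.1 hp
    · exact h.2.1
    · exact ih h.2.2 hp

/-- A detour between the images of `univ` and `univ \ {a}` is attached to the pair formed by these
two sets, and none to the other pairs. -/
theorem IsSetEnumeration.exists_detours {α : Type*} {Γ : SimpleGraph α} {f : Set V → α}
    {ps : List (Set V × Set V)} {k : ℕ} {s : Multiset α} (h : IsSetEnumeration a ps)
    (hf : ∀ X Y, TARAdj X Y → Γ.Adj (f X) (f Y))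
    (hdetour : FlexPath Γ (f univ) (f (univ \ {a})) k s) :
    ∃ (w : Set V × Set V → ℕ) (t : Set V × Set V → Multiset α), (ps.map w).sum = k ∧
      (ps.map t).sum = s ∧ ∀ p ∈ ps, FlexPath Γ (f p.1) (f p.2) (w p) (t p) := by
  classical
  obtain ⟨p₀, hp₀, hdetour⟩ : ∃ p₀ ∈ ps, FlexPath Γ (f p₀.1) (f p₀.2) k s :=
    h.univ_mem.elim (fun hp => ⟨_, hp, hdetour⟩) (fun hp => ⟨_, hp, hdetour.symm⟩)
  have hps : ps.Nodup := (List.nodup_flatMap.1 (List.nodup_cons.1 h.nodup).2).2.imp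
    fun hdisj => by rintro rfl; exact List.disjoint_left.1 hdisj List.mem_cons_self (by simp)
  refine ⟨fun p => if p = p₀ then k else 0, fun p => if p = p₀ then s else 0, ?_, ?_, ?_⟩
  · rw [← List.sum_toFinset _ hps, Finset.sum_ite_eq', if_pos (List.mem_toFinset.2 hp₀)]
  · rw [← List.sum_toFinset _ hps, Finset.sum_ite_eq', if_pos (List.mem_toFinset.2 hp₀)]
  · intro p hp
    by_cases hpp : p = p₀
    · simpa only [hpp, if_true] using hdetour
    · simpa only [hpp, if_false] using
        FlexPath.of_adj (hf _ _ (rel_of_mem_of_isChain_flattenPairs h.isChain hp))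

end GrayCode

section TokenGraph

variable {V : Type*} {W : Type*} {G : SimpleGraph V} {H : SimpleGraph W} {X X' : Set V}
  {Y Y' : Set W} {a : V} {b : W}

/-- The graph of all token moves, without the restriction to dominating sets. -/
def tokenGraph (G : SimpleGraph V) : SimpleGraph (Set V) where
  Adj X Y := TARAdj X Y ∨ TSAdj G X Y
  symm := ⟨fun _ _ h => h.imp TARAdj.symm TSAdj.symm⟩
  loopless := ⟨by
    rintro X (h | ⟨a, -, b, hb, -⟩)
    · obtain ⟨w, hw⟩ := tarAdj_iff_exists_toggle.1 h
      have := mem_toggle_self (w := w) (X := X)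
      rw [← hw] at this
      exact not_iff_self this.symm
    · exact hb.2 hb.1⟩

/-- The token graph of the join, with the subsets of `V ⊕ W` regarded as pairs of sets. -/
def pairGraph (G : SimpleGraph V) (H : SimpleGraph W) : SimpleGraph (Set V × Set W) :=
  (tokenGraph (G.join H)).comap Set.sumEquiv.symm

/-- The pairs of sets which form a dominating set of the join. -/
def dominatingPairs (G : SimpleGraph V) (H : SimpleGraph W) : Set (Set V × Set W) :=
  {p | (G.join H).IsDominatingSet (Set.sumEquiv.symm p)}

theorem isPancyclic_of_iso {α β : Type*} [Finite α] [Finite β] {Γ : SimpleGraph α}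
    {Δ : SimpleGraph β} (e : Γ ≃g Δ) (h : Γ.IsPancyclic) : Δ.IsPancyclic := by
  intro k hk hk'
  obtain ⟨x, p, hp, hlen⟩ := h k hk (by rwa [Nat.card_congr e.toEquiv])
  exact ⟨e x, p.map e.toHom, hp.map e.injective, by simpa using hlen⟩

theorem isPancyclic_join_of_pairGraph [Finite V] [Finite W]
    (h : ((pairGraph G H).induce (dominatingPairs G H)).IsPancyclic) :
    (G.join H).tarsGraph.IsPancyclic :=
  isPancyclic_of_iso
    ⟨Set.sumEquiv.symm.toEquiv.subtypeEquiv fun _ => Iff.rfl, Iff.rfl⟩ h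

@[simp] theorem join_adj_inl_inl {x y : V} : (G.join H).Adj (.inl x) (.inl y) ↔ G.Adj x y := by
  simp [join]

@[simp] theorem join_adj_inr_inr {x y : W} : (G.join H).Adj (.inr x) (.inr y) ↔ H.Adj x y := by
  simp [join]

@[simp] theorem join_adj_inl_inr {x : V} {y : W} : (G.join H).Adj (.inl x) (.inr y) := by
  simp [join]

@[simp] theorem join_adj_inr_inl {x : W} {y : V} : (G.join H).Adj (.inr x) (.inl y) := by
  simp [join]

theorem mem_dominatingPairs_iff [Nonempty V] [Nonempty W] :
    (X, Y) ∈ dominatingPairs G H ↔ X.Nonempty ∧ Y.Nonempty ∨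
      G.IsDominatingSet X ∧ Y = ∅ ∨ X = ∅ ∧ H.IsDominatingSet Y := by
  obtain ⟨_⟩ := ‹Nonempty V›
  obtain ⟨_⟩ := ‹Nonempty W›
  simp only [dominatingPairs, IsDominatingSet, mem_ofPred_eq, sumEquiv_symm_apply, Sum.forall,
    Sum.exists, mem_union, mem_image, Sum.inl.injEq, exists_eq_right, reduceCtorEq, and_false,
    exists_false, or_false, false_or, join_adj_inl_inl, join_adj_inr_inr, join_adj_inl_inr,
    join_adj_inr_inl, and_true, Sum.inr.injEq]
  obtain rfl | ⟨x, hx⟩ := X.eq_empty_or_nonempty <;> obtain rfl | ⟨y, hy⟩ := Y.eq_empty_or_nonempty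
  · simp
  · grind [nonempty_of_mem, Set.not_nonempty_empty]
  · grind [nonempty_of_mem, Set.not_nonempty_empty]
  · grind [nonempty_of_mem]

theorem pairGraph_adj_left (h : (tokenGraph G).Adj X X') :
    (pairGraph G H).Adj (X, Y) (X', Y) := by
  rcases h with h | ⟨u, hu, v, ⟨hv, hv'⟩, huv, rfl⟩
  · obtain ⟨w, rfl⟩ := tarAdj_iff_exists_toggle.1 h
    refine Or.inl (tarAdj_iff_exists_toggle.2 ⟨.inl w, ?_⟩)
    ext (x | x) <;> simp [Set.mem_symmDiff]
  · refine Or.inr ⟨.inl u, by simpa, .inl v, by simpa using ⟨hv.2, hv'⟩, by simpa, ?_⟩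
    ext (x | x) <;> simp

theorem pairGraph_adj_right (h : (tokenGraph H).Adj Y Y') :
    (pairGraph G H).Adj (X, Y) (X, Y') := by
  rcases h with h | ⟨u, hu, v, ⟨hv, hv'⟩, huv, rfl⟩
  · obtain ⟨w, rfl⟩ := tarAdj_iff_exists_toggle.1 h
    refine Or.inl (tarAdj_iff_exists_toggle.2 ⟨.inr w, ?_⟩)
    ext (x | x) <;> simp [Set.mem_symmDiff]
  · refine Or.inr ⟨.inr u, by simpa, .inr v, by simpa using ⟨hv.2, hv'⟩, by simpa, ?_⟩
    ext (x | x) <;> simp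

theorem pairGraph_slide (ha : a ∉ X) (hb : b ∉ Y) :
    (pairGraph G H).Adj (insert a X, Y) (X, insert b Y) := by
  refine Or.inr ⟨.inl a, by simp, .inr b, by simp [hb], by simp, ?_⟩
  ext (x | x)
  · simp only [sumEquiv_symm_apply, mem_union, mem_image, mem_sdiff, mem_insert_iff,
      mem_singleton_iff, Sum.inl.injEq, exists_eq_right, reduceCtorEq, and_false, exists_false]
    grind
  · simp

theorem tarAdj_iff_exists_insert {X X' : Set V} :
    TARAdj X X' ↔ (∃ w ∉ X, X' = insert w X) ∨ ∃ w ∉ X', X = insert w X' := by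
  refine or_congr Iff.rfl ⟨?_, ?_⟩
  · rintro ⟨w, hw, rfl⟩
    exact ⟨w, by simp, by rw [insert_sdiff_singleton, insert_eq_of_mem hw]⟩
  · rintro ⟨w, hw, rfl⟩
    refine ⟨w, mem_insert _ _, ?_⟩
    rw [insert_sdiff_of_mem _ (mem_singleton w), sdiff_singleton_eq_self hw]

theorem pairGraph_diag (hX : TARAdj X X') (hY : TARAdj Y Y') :
    (pairGraph G H).Adj (X, Y) (X', Y') ∨ (pairGraph G H).Adj (X', Y) (X, Y') := by
  rcases tarAdj_iff_exists_insert.1 hX with ⟨a, ha, rfl⟩ | ⟨a, ha, rfl⟩ <;>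
    rcases tarAdj_iff_exists_insert.1 hY with ⟨b, hb, rfl⟩ | ⟨b, hb, rfl⟩
  · exact Or.inr (pairGraph_slide ha hb)
  · exact Or.inl (pairGraph_slide ha hb).symm
  · exact Or.inl (pairGraph_slide ha hb)
  · exact Or.inr (pairGraph_slide ha hb).symm

end TokenGraph

section Tour

variable {V : Type*} {α : Type*} {Γ : SimpleGraph α} {G : SimpleGraph V} {X Y : Set V} {a : V}
  {l : List (Set V)} {f g : Set V → α}

theorem isDominatingSet_univ (G : SimpleGraph V) : G.IsDominatingSet univ :=
  fun w => Or.inl (mem_univ w)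

theorem isDominatingSet_mono (hXY : X ⊆ Y) (h : G.IsDominatingSet X) : G.IsDominatingSet Y :=
  fun w => (h w).imp (@hXY w) fun ⟨x, hx, hxw⟩ => ⟨x, hXY hx, hxw⟩

theorem tokenGraph_univ_adj_iff : (tokenGraph G).Adj univ X ↔ ∃ a, X = univ \ {a} := by
  refine ⟨?_, fun ⟨a, h⟩ => Or.inl (Or.inr ⟨a, mem_univ a, h⟩)⟩
  rintro ((⟨a, ha, -⟩ | ⟨a, -, rfl⟩) | ⟨a, -, b, ⟨-, hb⟩, -, -⟩)
  · exact absurd (mem_univ a) ha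
  · exact ⟨a, rfl⟩
  · exact absurd (mem_univ _) hb

/-- A Hamiltonian path of the TARS-graph which starts at `univ` and whose last vertex is
`univ \ {a}`, or else `univ` if there are no other vertices. -/
structure IsTour (G : SimpleGraph V) (a : V) (l : List (Set V)) : Prop where
  isChain : l.IsChain (tokenGraph G).Adj
  nodup : l.Nodup
  mem_iff : ∀ X, X ∈ l ↔ G.IsDominatingSet X
  head?_eq : l.head? = some univ
  getLast?_eq : l.getLast? = some univ ∨ l.getLast? = some (univ \ {a})

theorem exists_isTour_of_isHamiltonianCycle [DecidableEq (Set V)]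
    {p : G.tarsGraph.Walk ⟨univ, isDominatingSet_univ G⟩ ⟨univ, isDominatingSet_univ G⟩}
    (hp : p.IsHamiltonianCycle) : ∃ a l, IsTour G a l := by
  have hnil : ¬ p.Nil := hp.isCycle.not_nil
  obtain ⟨a, ha⟩ := tokenGraph_univ_adj_iff.1 (p.adj_snd hnil)
  refine ⟨a, (p.tail.support.map Subtype.val).reverse, ?_, ?_, fun X => ?_, ?_, ?_⟩
  · refine List.isChain_reverse.2 ((List.isChain_map _).2 ?_)
    exact p.tail.isChain_adj_support.imp fun _ _ h => h.symm
  · exact List.nodup_reverse.2 (hp.isHamiltonian_tail.isPath.support_nodup.map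
      Subtype.val_injective)
  · simp [hp.isHamiltonian_tail.mem_support]
  · rw [List.head?_reverse, List.getLast?_map,
      List.getLast?_eq_some_getLast (Walk.support_ne_nil _), Walk.getLast_support, Option.map_some]
  · rw [List.getLast?_reverse, List.head?_map, List.head?_eq_some_head (Walk.support_ne_nil _),
      Walk.head_support, Option.map_some, ha]
    exact Or.inr rfl

theorem exists_isTour [Finite V] [Nonempty V] (h : G.tarsGraph.IsPancyclic) :
    ∃ a l, IsTour G a l := by
  classical
  have := Fintype.ofFinite {X // G.IsDominatingSet X}
  have huniv := isDominatingSet_univ G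
  by_cases hall : ∃ X, G.IsDominatingSet X ∧ X ≠ univ
  · obtain ⟨X, hX, hne⟩ := hall
    obtain ⟨a, ha⟩ := (ne_univ_iff_exists_notMem X).1 hne
    have hXa : X ⊆ univ \ {a} := subset_sdiff_singleton (subset_univ X) ha
    by_cases hcard : 3 ≤ Nat.card {X // G.IsDominatingSet X}
    · obtain ⟨x, p, hp, hlen⟩ := h _ hcard le_rfl
      have hp : p.IsHamiltonianCycle := Walk.isHamiltonianCycle_iff_isCycle_and_length_eq.2
        ⟨hp, by rw [hlen, Nat.card_eq_fintype_card]⟩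
      exact exists_isTour_of_isHamiltonianCycle
        (hp.rotate (hp.mem_support ⟨univ, huniv⟩))
    · have hdom : G.IsDominatingSet (univ \ {a}) := isDominatingSet_mono hXa hX
      have hne' : univ \ {a} ≠ univ := fun h => (h.symm.subset (mem_univ a)).2 rfl
      refine ⟨a, [univ, univ \ {a}], ?_, by simpa using hne'.symm, fun Z => ?_, rfl, .inr rfl⟩
      · simpa using tokenGraph_univ_adj_iff.2 ⟨a, rfl⟩
      · simp only [List.mem_cons, List.not_mem_nil, or_false]
        refine ⟨by rintro (rfl | rfl) <;> assumption, fun hZ => ?_⟩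
        by_contra! hZ'
        rw [Nat.card_eq_fintype_card] at hcard
        exact hcard (Fintype.two_lt_card_iff.2 ⟨⟨Z, hZ⟩, ⟨univ, huniv⟩, ⟨_, hdom⟩,
          by simpa using hZ'.1, by simpa using hZ'.2, by simpa using hne'.symm⟩)
  · push Not at hall
    refine ⟨Classical.arbitrary V, [univ], List.isChain_singleton _, List.nodup_singleton _,
      fun X => ?_, rfl, .inl rfl⟩
    rw [List.mem_singleton]
    exact ⟨by rintro rfl; exact huniv, hall X⟩

theorem isChain_append_singleton_of_getLast? {R : α → α → Prop} {l : List α} {x y : α}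
    (h : l.IsChain R) (hx : l.getLast? = some x) (hxy : R x y) : (l ++ [y]).IsChain R :=
  h.append (List.isChain_singleton y) (by simpa [hx])

theorem isChain_cons_of_head? {R : α → α → Prop} {l : List α} {x y : α}
    (h : l.IsChain R) (hx : l.head? = some x) (hxy : R y x) : (y :: l).IsChain R :=
  h.cons (by simpa [hx])

/-- Two copies `f` and `g` of the power set, the first of which carries the token graph of `G`,
which are joined by all the edges that come from adding, or sliding in, one further token. -/
structure IsTokenPage (G : SimpleGraph V) (Γ : SimpleGraph α) (f g : Set V → α) : Prop where
  map_adj : ∀ X Y, (tokenGraph G).Adj X Y → Γ.Adj (f X) (f Y)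
  adj : ∀ X, Γ.Adj (f X) (g X)
  slide : ∀ a X, a ∉ X → Γ.Adj (f (insert a X)) (g X)

theorem IsTokenPage.adj_compl (h : IsTokenPage G Γ f g) (a : V) :
    Γ.Adj (f univ) (g (univ \ {a})) := by
  simpa [insert_eq_of_mem (mem_univ a)] using h.slide a (univ \ {a}) (by simp)

theorem IsTour.flexPath_of_adj {x : α} (h : IsTour G a l) (hfg : IsTokenPage G Γ f g)
    (hx : Γ.Adj x (f univ)) : FlexPath Γ x (g (univ \ {a})) l.length ↑(l.map f) := by
  have hchain : (l.map f).IsChain Γ.Adj :=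
    (List.isChain_map f).2 (h.isChain.imp hfg.map_adj)
  rw [← List.length_map f]
  refine .of_isChain (isChain_cons_of_head? ?_ ?_ hx)
  · rcases h.getLast?_eq with hlast | hlast
    · exact isChain_append_singleton_of_getLast? hchain (by simp [hlast]) (hfg.adj_compl a)
    · exact isChain_append_singleton_of_getLast? hchain (by simp [hlast]) (hfg.adj _)
  · simp [h.head?_eq]

theorem IsTour.flexPath (h : IsTour G a l) (hfg : IsTokenPage G Γ f g) :
    FlexPath Γ (g univ) (g (univ \ {a})) l.length ↑(l.map f) :=
  h.flexPath_of_adj hfg (hfg.adj univ).symm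

/-- The variant without the vertex `univ`, whose neighbour on the tour is of the form
`univ \ {a'}`. -/
theorem IsTour.exists_flexPath_of_three_le (h : IsTour G a l) (hl : 3 ≤ l.length)
    (hfg : IsTokenPage G Γ f g) :
    ∃ a' L, l = univ :: L ∧
      FlexPath Γ (g (univ \ {a})) (g ({a'} ∆ (univ \ {a}))) L.length ↑(L.map f) := by
  obtain ⟨L, rfl⟩ := List.head?_eq_some_iff.1 h.head?_eq
  obtain ⟨Y, L, rfl⟩ := List.exists_cons_of_length_pos (l := L) (by grind)
  obtain ⟨Z, L, rfl⟩ := List.exists_cons_of_length_pos (l := L) (by grind)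
  obtain ⟨a', rfl⟩ := tokenGraph_univ_adj_iff.1 (List.isChain_cons_cons.1 h.isChain).1
  have hlast : (Z :: L).getLast? = some (univ \ {a}) := by
    have := h.getLast?_eq
    rw [List.getLast?_cons_cons, List.getLast?_cons_cons] at this
    refine this.resolve_left fun huniv => (List.nodup_cons.1 h.nodup).1 ?_
    exact List.mem_cons_of_mem _ (List.mem_of_getLast? huniv)
  have hne : a ≠ a' := by
    rintro rfl
    exact (List.nodup_cons.1 (List.nodup_cons.1 h.nodup).2).1 (List.mem_of_getLast? hlast)
  have htoggle : {a'} ∆ (univ \ {a}) = (univ \ {a}) \ {a'} :=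
    toggle_of_mem ⟨mem_univ a', hne.symm⟩
  have hslide : Γ.Adj (f (univ \ {a'})) (g ({a'} ∆ (univ \ {a}))) := by
    convert hfg.slide a ({a'} ∆ (univ \ {a})) (by simp [htoggle]) using 2
    rw [htoggle, sdiff_sdiff_comm, insert_sdiff_singleton, insert_eq_of_mem]
    exact ⟨mem_univ a, hne⟩
  refine ⟨a', _, rfl, ?_⟩
  have hchain := (List.isChain_map f).2 (h.isChain.tail.imp hfg.map_adj)
  have := FlexPath.of_isChain (isChain_cons_of_head?
    (isChain_append_singleton_of_getLast? hchain (x := f (univ \ {a})) ?_ (hfg.adj _))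
    (x := f (univ \ {a'})) ?_ hslide.symm)
  · simpa using this.symm
  · rw [List.tail_cons, List.getLast?_map, List.getLast?_cons_cons, hlast, Option.map_some]
  · simp

end Tour

section Cone

variable {V : Type*} {W : Type*} {G : SimpleGraph V} {H : SimpleGraph W}

theorem isTokenPage_left (G : SimpleGraph V) (H : SimpleGraph W) (w : W) :
    IsTokenPage G (pairGraph G H) (·, ∅) (·, {w}) where
  map_adj _ _ := pairGraph_adj_left
  adj _ := pairGraph_adj_right (Or.inl (Or.inl ⟨w, notMem_empty w, (insert_empty_eq w).symm⟩))
  slide _ _ ha := by simpa using pairGraph_slide (G := G) (H := H) ha (notMem_empty w)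

theorem isTokenPage_right (G : SimpleGraph V) (H : SimpleGraph W) (v : V) :
    IsTokenPage H (pairGraph G H) (∅, ·) ({v}, ·) where
  map_adj _ _ := pairGraph_adj_right
  adj _ := pairGraph_adj_left (Or.inl (Or.inl ⟨v, notMem_empty v, (insert_empty_eq v).symm⟩))
  slide _ _ hb := by simpa using (pairGraph_slide (G := G) (H := H) (notMem_empty v) hb).symm

theorem natCard_le_card_of_forall_mem {α : Type*} {S : Set α} {s : Multiset α}
    (h : ∀ x ∈ S, x ∈ s) : Nat.card S ≤ s.card := by
  classical
  calc Nat.card S ≤ Nat.card s.toFinset := Nat.card_mono s.toFinset.finite_toSet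
        fun x hx => by simpa using h x hx
    _ = s.toFinset.card := Nat.card_eq_finsetCard _
    _ ≤ s.card := s.toFinset_card_le

/-- A Gray code of a subcube is run through forwards, and then backwards with `v` toggled. -/
theorem exists_isChain_toggle [Finite V] (v : V) (X : Set V) {j : ℕ} (hj : j ≠ 0)
    (hj' : j ≤ 2 ^ (Nat.card V - 1)) : ∃ l : List (Set V), l.length + 2 = 2 * j ∧
      (X :: (l ++ [{v} ∆ X])).IsChain TARAdj ∧ (X :: (l ++ [{v} ∆ X])).Nodup := by
  obtain ⟨l, L, hnd, -, hL, hchain, hlength⟩ := exists_grayCode_eq_cons v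
  have hnodup : (∅ :: L).Nodup := hL ▸ nodup_grayCode (List.nodup_cons.1 hnd).2
  have hv : ∀ Y ∈ ∅ :: L, v ∉ Y := fun Y hY hv =>
    (List.nodup_cons.1 hnd).1 (mem_grayCode.1 (hL ▸ hY) v hv)
  obtain ⟨i, rfl⟩ := Nat.exists_eq_succ_of_ne_zero hj
  have htake := List.take_sublist (i + 1) (∅ :: L)
  have hchain' := isChain_map_symmDiff X (isChain_reflect v (hchain.take (i + 1)))
  have hnodup' := (nodup_reflect (hnodup.sublist htake) fun Y hY => hv Y (htake.subset hY)).map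
    (symmDiff_right_injective X)
  have hreflect : (reflect v ((∅ :: L).take (i + 1))).map (X ∆ ·) =
      X :: ((L.take i ++ (L.take i).reverse.map ({v} ∆ ·)).map (X ∆ ·) ++ [{v} ∆ X]) := by
    have : X ∆ {v} = {v} ∆ X := symmDiff_comm _ _
    simp [reflect, ← bot_eq_empty, this]
  rw [hreflect] at hchain' hnodup'
  refine ⟨_, ?_, hchain', hnodup'⟩
  simp only [List.length_map, List.length_append, List.length_take, List.length_reverse]
  omega

/-- The dominating sets in `l`, paired with `∅`, are the interior vertices of a path between two
neighbouring vertices of the cube formed by the pairs `(X, {w})`. -/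
structure IsConeDetour (G : SimpleGraph V) (H : SimpleGraph W) (w : W) (X : Set V) (v : V)
    (l : List (Set V)) : Prop where
  flexPath : FlexPath (pairGraph G H) (X, {w}) ({v} ∆ X, {w}) l.length ↑(l.map (·, (∅ : Set W)))
  nodup : l.Nodup
  isDominatingSet : ∀ Y ∈ l, G.IsDominatingSet Y

theorem mem_dominatingPairs_singleton [Nonempty V] [Subsingleton W] (X : Set V) (w : W) :
    (X, {w}) ∈ dominatingPairs G H := by
  have : Nonempty W := ⟨w⟩
  rw [mem_dominatingPairs_iff]
  obtain rfl | hX := X.eq_empty_or_nonempty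
  · exact Or.inr (Or.inr ⟨rfl, fun x => Or.inl (Subsingleton.elim x w)⟩)
  · exact Or.inl ⟨hX, singleton_nonempty w⟩

theorem IsConeDetour.hasCycle [Finite V] [Nonempty V] [Subsingleton W] {w : W} {X : Set V}
    {v : V} {l : List (Set V)} (h : IsConeDetour G H w X v l) {k : ℕ} (hk : 3 ≤ k)
    (hk' : k ≤ 2 ^ Nat.card V + l.length) (hlk : l.length < k) (heven : Even (k - l.length)) :
    HasCycle ((pairGraph G H).induce (dominatingPairs G H)) k := by
  have hW : Nonempty W := ⟨w⟩
  obtain ⟨j, hj⟩ := heven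
  have hpow : 2 ^ Nat.card V = 2 * 2 ^ (Nat.card V - 1) :=
    (mul_pow_sub_one Nat.card_pos.ne' 2).symm
  obtain ⟨L, hL, hchain, hnodup⟩ := exists_isChain_toggle v X (j := j) (by omega) (by omega)
  have hcube : FlexPath (pairGraph G H) (X, {w}) ({v} ∆ X, {w}) L.length
      ↑(L.map (·, ({w} : Set W))) := by
    rw [← List.length_map (·, ({w} : Set W))]
    refine .of_isChain ?_
    have := (List.isChain_map (R := (pairGraph G H).Adj) (·, {w})).2
      (hchain.imp fun Y Z hYZ => pairGraph_adj_left (Or.inl hYZ))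
    simpa using this
  refine (hcube.trans h.flexPath.symm).hasCycle ?_ ?_ (k := k) ?_ ?_ hk
  · have : ((X :: (L ++ [{v} ∆ X])).map (·, ({w} : Set W)) ++ l.map (·, ∅)).Nodup := by
      refine (hnodup.map (Prod.mk_left_injective _)).append
        (h.nodup.map (Prod.mk_left_injective _)) ?_
      simp only [List.disjoint_left, List.mem_map]
      rintro _ ⟨Y, -, rfl⟩ ⟨Z, -, hZ⟩
      exact singleton_ne_empty w (congrArg Prod.snd hZ).symm
    rw [← Multiset.coe_nodup] at this
    convert this using 1
    simp only [List.map_cons, List.map_append, List.map_nil, List.cons_append, List.append_assoc,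
      ← Multiset.cons_coe, ← Multiset.coe_add, ← Multiset.singleton_add]
    abel
  · simp only [Multiset.mem_cons, Multiset.mem_add, Multiset.mem_coe, List.mem_map]
    rintro x (rfl | rfl | ⟨Y, -, rfl⟩ | ⟨Y, hY, rfl⟩)
    iterate 3 exact mem_dominatingPairs_singleton _ _
    exact mem_dominatingPairs_iff.2 (Or.inr (Or.inl ⟨h.isDominatingSet Y hY, rfl⟩))
  · omega
  · rw [Multiset.card_cons, Multiset.card_add, Multiset.coe_card, Multiset.coe_card,
      List.length_map, List.length_map]
    omega

theorem isConeDetour_nil (w : W) (X : Set V) (v : V) : IsConeDetour G H w X v [] where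
  flexPath := .of_adj (pairGraph_adj_left (Or.inl (tarAdj_toggle v X)))
  nodup := List.nodup_nil
  isDominatingSet := by simp

theorem isConeDetour_singleton_univ (w : W) (v : V) : IsConeDetour G H w univ v [univ] where
  flexPath := by
    have h := isTokenPage_left G H w
    have hslide := h.slide v ({v} ∆ univ) (by simp [mem_toggle_self])
    rw [toggle_of_mem (mem_univ v), insert_sdiff_singleton, insert_eq_of_mem (mem_univ v)] at hslide
    rw [toggle_of_mem (mem_univ v)]
    exact .of_isChain (l := [(univ, ∅)]) (by simpa using ⟨(h.adj univ).symm, hslide⟩)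
  nodup := List.nodup_singleton _
  isDominatingSet := by simp [isDominatingSet_univ]

theorem IsTour.isConeDetour {a : V} {l : List (Set V)} (h : IsTour G a l) (w : W) :
    IsConeDetour G H w univ a l where
  flexPath := by
    simpa [toggle_of_mem (mem_univ a)] using h.flexPath (isTokenPage_left G H w)
  nodup := h.nodup
  isDominatingSet X hX := (h.mem_iff X).1 hX

theorem IsTour.exists_isConeDetour {a : V} {l : List (Set V)} (h : IsTour G a l) (w : W) :
    ∃ X v L, L.length + 1 = l.length ∧ IsConeDetour G H w X v L := by
  obtain hl | hl : l.length ≤ 2 ∨ 3 ≤ l.length := by omega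
  · obtain ⟨L, rfl⟩ := List.head?_eq_some_iff.1 h.head?_eq
    rcases L with _ | ⟨Y, _ | _⟩
    · exact ⟨univ, a, [], rfl, isConeDetour_nil w univ a⟩
    · exact ⟨univ, a, [univ], rfl, isConeDetour_singleton_univ w a⟩
    · simp at hl
  · obtain ⟨a', L, rfl, hL⟩ := h.exists_flexPath_of_three_le hl (isTokenPage_left G H w)
    exact ⟨univ \ {a}, a', L, rfl, hL, (List.nodup_cons.1 h.nodup).2,
      fun X hX => (h.mem_iff X).1 (List.mem_cons_of_mem _ hX)⟩

theorem IsTour.natCard_dominatingPairs_le [Finite V] [Subsingleton W] [Nonempty V] (w : W) {a : V}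
    {l : List (Set V)} (h : IsTour G a l) :
    Nat.card (dominatingPairs G H) ≤ 2 ^ Nat.card V + l.length := by
  have := Fintype.ofFinite V
  have : Nonempty W := ⟨w⟩
  have hmem : ∀ p ∈ dominatingPairs G H,
      p ∈ Finset.univ.val.map (fun X : Set V => (X, ({w} : Set W))) +
        ↑(l.map fun X => (X, (∅ : Set W))) := by
    rintro ⟨X, Y⟩ hXY
    simp only [Multiset.mem_add, Multiset.mem_map, Multiset.mem_coe, List.mem_map, Finset.mem_val,
      Finset.mem_univ, true_and, h.mem_iff, Prod.mk.injEq]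
    obtain rfl | ⟨x, rfl⟩ := (Set.subsingleton_of_subsingleton (s := Y)).eq_empty_or_singleton
    · rcases mem_dominatingPairs_iff.1 hXY with ⟨-, hY⟩ | ⟨hX, -⟩ | ⟨-, hY⟩
      · exact absurd rfl hY.ne_empty
      · exact Or.inr ⟨X, hX, rfl, rfl⟩
      · simpa using hY w
    · exact Or.inl ⟨X, rfl, by rw [Subsingleton.elim x w]⟩
  simpa [Fintype.card_set] using natCard_le_card_of_forall_mem hmem

theorem isPancyclic_pairGraph_of_subsingleton [Finite V] [Nonempty V] [Finite W] [Subsingleton W]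
    (w : W) (h : G.tarsGraph.IsPancyclic) :
    ((pairGraph G H).induce (dominatingPairs G H)).IsPancyclic := by
  obtain ⟨a, l, hl⟩ := exists_isTour h
  obtain ⟨X, v, L, hlength, hL⟩ := hl.exists_isConeDetour (H := H) w
  intro k hk hk'
  have hcard := hk'.trans (hl.natCard_dominatingPairs_le w)
  have hV : Even (2 ^ Nat.card V) := Nat.even_pow.2 ⟨even_two, Nat.card_pos.ne'⟩
  rcases le_or_gt k (2 ^ Nat.card V + 1) with hsmall | hlarge
  · rcases Nat.even_or_odd k with hpar | hpar
    · exact (isConeDetour_nil w univ a).hasCycle hk (by grind) (Nat.zero_lt_of_lt hk) hpar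
    · exact (isConeDetour_singleton_univ w a).hasCycle hk hsmall
        (Nat.one_lt_two.trans hk) (Nat.Odd.sub_odd hpar odd_one)
  · have hllt : l.length < k := by
      have := Fintype.ofFinite V
      have := hl.nodup.length_le_card
      rw [Fintype.card_set, ← Nat.card_eq_fintype_card] at this
      omega
    rcases Nat.even_or_odd (k - l.length) with hpar | hpar
    · exact (hl.isConeDetour w).hasCycle hk hcard hllt hpar
    · exact hL.hasCycle hk (by grind) (by omega) (by grind)

end Cone

section Spine

variable {V : Type*} {W : Type*} {G : SimpleGraph V} {H : SimpleGraph W} {X X' X₀ X₁ X₂ : Set V}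
  {Y Y' y y₀ y₁ y₂ y₃ y₄ : Set W}

theorem ladderStep_left (hX : TARAdj X X') (hY : TARAdj Y Y') :
    LadderStep (pairGraph G H) (X, ·) (X', ·) Y Y' where
  left := pairGraph_adj_right (Or.inl hY)
  right := pairGraph_adj_right (Or.inl hY)
  rung := pairGraph_adj_left (Or.inl hX)
  diag := (pairGraph_diag hX hY).imp_right SimpleGraph.Adj.symm

theorem ladderStep_right (hX : TARAdj X X') (hY : TARAdj Y Y') :
    LadderStep (pairGraph G H) (·, Y) (·, Y') X X' where
  left := pairGraph_adj_left (Or.inl hX)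
  right := pairGraph_adj_left (Or.inl hX)
  rung := pairGraph_adj_right (Or.inl hY)
  diag := pairGraph_diag hX hY

theorem flexPath_strip (hX : TARAdj X X') {l : List (Set W)} (hl : (Y :: l).IsChain TARAdj) :
    FlexPath (pairGraph G H) (X, Y) (X', Y) 0 ({X, X'} ×ˢ (l : Multiset (Set W))) := by
  induction l generalizing Y with
  | nil => exact .of_adj (pairGraph_adj_left (Or.inl hX))
  | cons Z l ih =>
    rw [List.isChain_cons_cons] at hl
    have h := ladderStep_left (G := G) (H := H) hX hl.1
    convert FlexPath.square (pairGraph_adj_left (Or.inl hX)) (.of_adj h.left) (ih hl.2)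
      (.of_adj h.right.symm) h.diag using 1
    · rfl
    · simp only [Multiset.insert_eq_cons, ← Multiset.cons_coe, ← Multiset.singleton_add,
        Multiset.add_product, Multiset.product_add, Multiset.product_singleton]
      abel

theorem sum_map_flattenPairs {α β : Type*} (f : β → α) (ps : List (β × β)) :
    (ps.map fun p => f p.1 ::ₘ {f p.2}).sum = (flattenPairs ps : Multiset β).map f := by
  induction ps with
  | nil => rfl
  | cons p ps ih => simp [ih, Multiset.singleton_add]

theorem flexPath_square (hX : TARAdj X X') (hY : TARAdj Y Y') :
    FlexPath (pairGraph G H) (X, Y) (X, Y') 0 ((X', Y) ::ₘ {(X', Y')}) := by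
  have h := ladderStep_right (G := G) (H := H) hX hY
  simpa [pad] using FlexPath.square (pairGraph_adj_right (Or.inl hY)) (.of_adj h.left)
    (.of_adj h.rung) (.of_adj h.right.symm) h.diag

theorem flexPath_column (h₀₁ : TARAdj X₀ X₁) (h₁₂ : TARAdj X₁ X₂) {ps : List (Set W × Set W)}
    (hps : (y :: flattenPairs ps).IsChain TARAdj) {w : Set W × Set W → ℕ}
    {s : Set W × Set W → Multiset (Set V × Set W)}
    (hs : ∀ p ∈ ps, FlexPath (pairGraph G H) (X₂, p.1) (X₂, p.2) (w p) (s p)) :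
    FlexPath (pairGraph G H) (X₂, y) (X₁, y) (pad (ps.map w).sum (4 * ps.length))
      ({X₀, X₁, X₂} ×ˢ (flattenPairs ps : Multiset (Set W)) + (ps.map s).sum) := by
  convert FlexPath.ladder (Γ := pairGraph G H) (f := (X₂, ·)) (g := (X₁, ·)) ps y
    (pairGraph_adj_left (Or.inl h₁₂.symm)) (hps.imp fun _ _ h => ladderStep_left h₁₂.symm h) hs
    (t := fun p => (X₀, p.1) ::ₘ {(X₀, p.2)}) fun p hp =>
      flexPath_square h₀₁.symm (rel_of_mem_of_isChain_flattenPairs hps hp) using 1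
  rw [ladderVertices, sum_map_flattenPairs]
  simp only [Multiset.insert_eq_cons, Multiset.cons_product, ← Multiset.cons_zero,
    Multiset.zero_product]
  abel

theorem flexPath_wideStrip (h₀₁ : TARAdj X₀ X₁) (h₁₂ : TARAdj X₁ X₂)
    {ps : List (Set W × Set W)} {w : Set W × Set W → ℕ}
    {s : Set W × Set W → Multiset (Set V × Set W)}
    (hps : (flattenPairs ((y₁, y₂) :: (y₃, y₄) :: ps)).IsChain TARAdj)
    (hslide : (pairGraph G H).Adj (X₀, y₄) (X₁, y₃))
    (hs : ∀ p ∈ (y₁, y₂) :: (y₃, y₄) :: ps,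
      FlexPath (pairGraph G H) (X₂, p.1) (X₂, p.2) (w p) (s p)) :
    FlexPath (pairGraph G H) (X₂, y₁) (X₁, y₁)
      (pad ((((y₁, y₂) :: (y₃, y₄) :: ps).map w).sum) (4 * ps.length + 6))
      ({X₀, X₁, X₂} ×ˢ (↑(y₂ :: y₃ :: y₄ :: flattenPairs ps) : Multiset (Set W)) +
        (((y₁, y₂) :: (y₃, y₄) :: ps).map s).sum) := by
  simp only [flattenPairs_cons, List.isChain_cons_cons] at hps
  obtain ⟨h12, h23, h34, hps⟩ := hps
  simp only [List.mem_cons, forall_eq_or_imp] at hs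
  obtain ⟨hs₁, hs₃, hs⟩ := hs
  have adj_left {y : Set W} : (pairGraph G H).Adj (X₂, y) (X₁, y) :=
    pairGraph_adj_left (Or.inl h₁₂.symm)
  have step {y y' : Set W} (h : TARAdj y y') := ladderStep_left (G := G) (H := H) h₁₂.symm h
  have top := FlexPath.square adj_left hs₃ (flexPath_column h₀₁ h₁₂ hps hs)
    (.triangle (pairGraph_adj_right (Or.inl h34.symm)) (pairGraph_adj_left (Or.inl h₀₁.symm))
      hslide)
    (step h34).diag
  have middle := FlexPath.square adj_left (.of_adj (step h23).left) top
    (flexPath_square h₀₁.symm h23.symm) (step h23).diag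
  have bottom := FlexPath.square adj_left hs₁ middle (.of_adj (step h12).right.symm) (step h12).diag
  have hcard := sum_map_le_card_sum_map fun p hp => (hs p hp).1
  convert bottom.mono _ ((pad_le _ _).trans _) using 1
  · simp only [Multiset.insert_eq_cons, ← Multiset.cons_coe, ← Multiset.singleton_add,
      Multiset.add_product, Multiset.product_add, Multiset.product_singleton, List.map_cons,
      List.sum_cons]
    abel
  · simp only [List.map_cons, List.sum_cons]
    unfold pad
    grind
  · have := hs₁.1
    have := hs₃.1
    simp only [List.map_cons, List.sum_cons, Multiset.card_add, Multiset.card_cons,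
      Multiset.card_product, Multiset.coe_card, length_flattenPairs, Multiset.insert_eq_cons,
      Multiset.card_singleton]
    omega

theorem sum_map_pair_product {α β : Type*} (ps : List (β × β)) (t : Multiset α) :
    (ps.map fun p => ({p.1, p.2} : Multiset β) ×ˢ t).sum = (flattenPairs ps : Multiset β) ×ˢ t := by
  induction ps with
  | nil => rfl
  | cons p ps ih =>
    rw [List.map_cons, List.sum_cons, ih]
    simp only [flattenPairs_cons, ← Multiset.cons_coe, Multiset.insert_eq_cons,
      ← Multiset.singleton_add, Multiset.add_product, add_assoc]

theorem product_singleton_eq_map {α β : Type*} (s : Multiset α) (b : β) :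
    s ×ˢ ({b} : Multiset β) = s.map (·, b) := by
  rw [← Multiset.cons_zero, Multiset.product_cons, Multiset.product_zero, add_zero]

theorem exists_flexPath_spine {rs : List (Set V × Set V)} {C : List (Set W)}
    {w : Set V × Set V → ℕ} {s : Set V × Set V → Multiset (Set V × Set W)} {m n : ℕ}
    {t : Multiset (Set V × Set W)}
    (hrs : (X₀ :: flattenPairs ((X₁, X₂) :: rs)).IsChain TARAdj)
    (hC : (y₀ :: y₁ :: C).IsChain TARAdj)
    (hs : ∀ p ∈ (X₁, X₂) :: rs, FlexPath (pairGraph G H) (p.1, y₀) (p.2, y₀) (w p) (s p))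
    (hstrip : FlexPath (pairGraph G H) (X₂, y₁) (X₁, y₁) (pad m n)
      (({X₀, X₁, X₂} : Multiset (Set V)) ×ˢ (C : Multiset (Set W)) + t))
    (hm : m ≤ t.card) (hn : n ≤ 3 * C.length) :
    ∃ T, FlexPath (pairGraph G H) (X₀, y₀) (X₀, y₀)
        (pad ((((X₁, X₂) :: rs).map w).sum + m) (4 * rs.length + n + 4) + 1) T ∧
      (X₀, y₀) ::ₘ T = (↑(X₀ :: X₁ :: X₂ :: flattenPairs rs) : Multiset (Set V)) ×ˢ
        (↑(y₀ :: y₁ :: C) : Multiset (Set W)) + (((X₁, X₂) :: rs).map s).sum + t := by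
  simp only [flattenPairs_cons, List.isChain_cons_cons] at hrs hC
  obtain ⟨h₀₁, h₁₂, hrs⟩ := hrs
  obtain ⟨hy, hC⟩ := hC
  simp only [List.mem_cons, forall_eq_or_imp] at hs
  have hcard := sum_map_le_card_sum_map fun p hp => (hs.2 p hp).1
  have step {X X' : Set V} (h : TARAdj X X') := ladderStep_right (G := G) (H := H) h hy
  have adj_right {X : Set V} : (pairGraph G H).Adj (X, y₀) (X, y₁) :=
    pairGraph_adj_right (Or.inl hy)
  have teeth := FlexPath.ladder (Γ := pairGraph G H) (f := (·, y₀)) (g := (·, y₁)) rs X₂ adj_right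
    (hrs.imp fun _ _ => step) hs.2 fun p hp =>
      flexPath_strip (rel_of_mem_of_isChain_flattenPairs hrs hp) hC
  have inner := FlexPath.square adj_right hs.1 teeth hstrip (step h₁₂).diag
  have outer := FlexPath.square adj_right (.of_adj (step h₀₁).left) inner
    (.of_adj (step h₀₁).right.symm) (step h₀₁).diag
  refine ⟨_, (outer.trans (.of_adj adj_right.symm)).mono ?_ ?_, ?_⟩
  · simp only [List.map_cons, List.sum_cons]
    unfold pad
    grind
  · grw [pad_le]
    have := hs.1.1
    simp only [ladderVertices, List.map_cons, List.sum_cons, Multiset.card_add, Multiset.card_cons,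
      Multiset.card_map, Multiset.coe_card, length_flattenPairs, Multiset.card_product,
      Multiset.insert_eq_cons, Multiset.card_singleton, Multiset.card_zero]
    omega
  · rw [ladderVertices, sum_map_pair_product, ← product_singleton_eq_map,
      ← product_singleton_eq_map]
    simp only [List.map_cons, List.sum_cons, ← Multiset.cons_coe, Multiset.insert_eq_cons,
      ← Multiset.singleton_add, Multiset.add_product, Multiset.product_add,
      Multiset.product_singleton]
    abel

/-- The nonempty subsets of a finite type. -/
noncomputable def nonemptySets (V : Type*) [Finite V] : Finset (Set V) :=
  (toFinite {X : Set V | X.Nonempty}).toFinset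

@[simp] theorem mem_nonemptySets [Finite V] : X ∈ nonemptySets V ↔ X.Nonempty := by
  simp [nonemptySets]

theorem card_nonemptySets (V : Type*) [Finite V] : (nonemptySets V).card + 1 = 2 ^ Nat.card V := by
  classical
  have := Fintype.ofFinite V
  have hcompl : (nonemptySets V)ᶜ = {∅} := by
    ext X
    simp [not_nonempty_iff_eq_empty]
  have := Finset.card_add_card_compl (nonemptySets V)
  rwa [hcompl, Finset.card_singleton, Fintype.card_set, ← Nat.card_eq_fintype_card] at this

theorem IsSetEnumeration.coe_eq [Finite V] {a : V} {ps : List (Set V × Set V)}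
    (h : IsSetEnumeration a ps) :
    (({a} :: flattenPairs ps : List (Set V)) : Multiset (Set V)) = (nonemptySets V).val :=
  (Multiset.Nodup.ext (Multiset.coe_nodup.2 h.nodup) (nonemptySets V).nodup).2 fun X => by
    rw [Multiset.mem_coe, h.mem_iff, Finset.mem_val, mem_nonemptySets]

theorem exists_flexPath_grid [Finite V] [Nontrivial V] [Finite W] (hW : 3 ≤ Nat.card W)
    (G : SimpleGraph V) (H : SimpleGraph W) (a : V) (b : W) :
    ∃ c, ∀ {k m} {s t : Multiset (Set V × Set W)},
      FlexPath (pairGraph G H) (univ, {b}) (univ \ {a}, {b}) k s →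
      FlexPath (pairGraph G H) ({c}, univ) ({c}, univ \ {b}) m t →
      ∃ T, FlexPath (pairGraph G H) ({a}, {b}) ({a}, {b})
          (pad (k + m) (2 * (nonemptySets V).card + 2 * (nonemptySets W).card - 6) + 1) T ∧
        ({a}, {b}) ::ₘ T = (nonemptySets V).val ×ˢ (nonemptySets W).val + s + t := by
  obtain ⟨c, rs, hca, hrs⟩ := IsSetEnumeration.exists_cons_insert a
  obtain ⟨⟨y₁, y₂⟩, U, cs, hbU, hcs⟩ := IsSetEnumeration.exists_cons_cons_insert hW b
  refine ⟨c, fun {k m s t} hA hB => ?_⟩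
  have hchain := hrs.isChain
  rw [flattenPairs_cons, List.isChain_cons_cons, List.isChain_cons_cons] at hchain
  have hV := congrArg Multiset.card hrs.coe_eq
  have hW' := congrArg Multiset.card hcs.coe_eq
  simp only [Multiset.coe_card, List.length_cons, flattenPairs_cons, length_flattenPairs,
    Finset.card_val] at hV hW'
  obtain ⟨w, s, rfl, rfl, hrow⟩ := hrs.exists_detours (Γ := pairGraph G H) (f := (·, {b}))
    (fun _ _ h => pairGraph_adj_left (Or.inl h)) hA
  obtain ⟨w', t, rfl, rfl, hcol⟩ := hcs.exists_detours (Γ := pairGraph G H) (f := ({c}, ·))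
    (fun _ _ h => pairGraph_adj_right (Or.inl h)) hB
  have strip := flexPath_wideStrip hchain.1 hchain.2.1 (List.isChain_cons.1 hcs.isChain).2
    (pairGraph_slide (by simpa using hca) hbU).symm hcol
  obtain ⟨T, hT, hgrid⟩ := exists_flexPath_spine
    (C := y₂ :: U :: insert b U :: flattenPairs cs) hrs.isChain hcs.isChain hrow strip
    (sum_map_le_card_sum_map fun p hp => (hcol p hp).1)
    (by simp only [List.length_cons, length_flattenPairs]; omega)
  refine ⟨T, ?_, ?_⟩
  · convert hT using 4
    omega
  · rw [hgrid, ← hrs.coe_eq, ← hcs.coe_eq]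
    rfl

end Spine

section Cycles

variable {V : Type*} {W : Type*} {G : SimpleGraph V} {H : SimpleGraph W} {a c : V} {b d : W}
  {m k : ℕ} {s t : Multiset (Set V × Set W)}

theorem pairGraph_slide_univ (a : V) (b : W) :
    (pairGraph G H).Adj (univ, univ \ {b}) (univ \ {a}, univ) := by
  simpa [insert_eq_of_mem (mem_univ a), insert_eq_of_mem (mem_univ b)] using
    pairGraph_slide (G := G) (H := H) (X := univ \ {a}) (Y := univ \ {b}) (a := a) (b := b)
      (by simp) (by simp)

theorem tarAdj_univ_compl (a : V) : TARAdj univ (univ \ {a}) :=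
  Or.inr ⟨a, mem_univ a, rfl⟩

theorem flexPath_fan (c : V) (b d : W) :
    FlexPath (pairGraph G H) (univ, univ \ {d}) (univ, univ \ {d}) 1
      ((univ, univ) ::ₘ {(univ \ {c}, univ), (univ, univ \ {b})}) :=
  (FlexPath.square (pairGraph_adj_right (Or.inl (tarAdj_univ_compl d).symm))
    (.of_adj (pairGraph_slide_univ c d)) (.of_adj (pairGraph_slide_univ c b).symm)
    (.of_adj (pairGraph_adj_right (Or.inl (tarAdj_univ_compl b).symm)))
    (Or.inr (pairGraph_adj_left (Or.inl (tarAdj_univ_compl c).symm)))).trans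
  (.of_adj (pairGraph_adj_right (Or.inl (tarAdj_univ_compl d))))

/-- In the `3 × 3` grid of all pairs formed from `univ`, `univ \ {a}`, `univ \ {c}` and from `univ`,
`univ \ {b}`, `univ \ {d}` the diagonals cut off the corners. -/
theorem flexPath_threeByThree
    (hA : FlexPath (pairGraph G H) (univ \ {a}, univ) (univ, univ \ {d}) k s)
    (hB : FlexPath (pairGraph G H) (univ \ {c}, univ) (univ \ {c}, univ \ {b}) m t) :
    FlexPath (pairGraph G H) (univ, univ \ {d}) (univ, univ \ {d}) (k + m + 4)
      ({(univ, univ), (univ \ {c}, univ), (univ, univ \ {b}), (univ \ {c}, univ \ {b}),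
        (univ \ {a}, univ \ {b}), (univ \ {a}, univ)} + s + t) := by
  have center : FlexPath (pairGraph G H) (univ, univ \ {d}) (univ \ {c}, univ) 0 {(univ, univ)} :=
    .triangle (pairGraph_slide_univ c d)
      (pairGraph_adj_right (Or.inl (tarAdj_univ_compl d).symm))
      (pairGraph_adj_left (Or.inl (tarAdj_univ_compl c)))
  have side : (pairGraph G H).Adj (univ \ {c}, univ \ {b}) (univ, univ \ {b}) :=
    pairGraph_adj_left (Or.inl (tarAdj_univ_compl c).symm)
  have corner : FlexPath (pairGraph G H) (univ, univ \ {b}) (univ \ {a}, univ) 0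
      {(univ \ {a}, univ \ {b})} :=
    .triangle (pairGraph_slide_univ a b) (pairGraph_adj_left (Or.inl (tarAdj_univ_compl a)))
      (pairGraph_adj_right (Or.inl (tarAdj_univ_compl b).symm))
  convert (((center.trans hB).trans (.of_adj side)).trans corner).trans hA using 1
  · omega
  · simp only [Multiset.insert_eq_cons, ← Multiset.singleton_add]
    abel

/-- The pairs of nonempty sets, and the pairs of the empty set and a set from one of the lists. -/
noncomputable def gridVertices [Finite V] [Finite W] (l : List (Set V)) (l' : List (Set W)) :
    Multiset (Set V × Set W) :=
  (nonemptySets V).val ×ˢ (nonemptySets W).val + ↑(l.map (·, (∅ : Set W))) +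
    ↑(l'.map ((∅ : Set V), ·))

theorem mem_gridVertices [Finite V] [Finite W] {l : List (Set V)} {l' : List (Set W)} {X : Set V}
    {Y : Set W} : (X, Y) ∈ gridVertices l l' ↔
      (X.Nonempty ∧ Y.Nonempty ∨ X ∈ l ∧ Y = ∅) ∨ X = ∅ ∧ Y ∈ l' := by
  simp [gridVertices, eq_comm, and_comm]

theorem card_gridVertices [Finite V] [Finite W] (l : List (Set V)) (l' : List (Set W)) :
    (gridVertices l l').card =
      (nonemptySets V).card * (nonemptySets W).card + l.length + l'.length := by
  simp [gridVertices]

theorem nodup_gridVertices [Finite V] [Finite W] {l : List (Set V)} {l' : List (Set W)}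
    (hl : l.Nodup) (hl' : l'.Nodup) (hne : ∅ ∉ l) : (gridVertices l l').Nodup := by
  simp only [gridVertices, Multiset.nodup_add, Multiset.coe_nodup, Multiset.disjoint_left,
    Multiset.mem_add, Multiset.mem_coe, List.mem_map, Multiset.mem_product, Finset.mem_val,
    mem_nonemptySets]
  refine ⟨⟨(nonemptySets V).nodup.product (nonemptySets W).nodup,
    hl.map (Prod.mk_left_injective _), ?_⟩, hl'.map (Prod.mk_right_injective _), ?_⟩
  · rintro _ ⟨-, hY⟩ ⟨X, -, rfl⟩
    exact hY.ne_empty rfl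
  · rintro _ (⟨hX, -⟩ | ⟨X, hX, rfl⟩) ⟨Y, -, hY⟩
    · rw [← hY] at hX
      exact hX.ne_empty rfl
    · obtain ⟨rfl, -⟩ := Prod.mk.inj hY
      exact hne hX

theorem three_le_card_nonemptySets [Finite V] (hV : 2 ≤ Nat.card V) :
    3 ≤ (nonemptySets V).card := by
  have := card_nonemptySets V
  have := Nat.pow_le_pow_right two_pos hV
  omega

theorem seven_le_card_nonemptySets [Finite V] (hV : 3 ≤ Nat.card V) :
    7 ≤ (nonemptySets V).card := by
  have := card_nonemptySets V
  have := Nat.pow_le_pow_right two_pos hV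
  omega

theorem IsTour.notMem_empty [Nonempty V] {l : List (Set V)} (h : IsTour G a l) : ∅ ∉ l := by
  rw [h.mem_iff]
  exact fun hdom => by simpa using hdom (Classical.arbitrary V)

theorem IsTour.length_le_card_nonemptySets [Finite V] [Nonempty V] {l : List (Set V)}
    (h : IsTour G a l) : l.length ≤ (nonemptySets V).card := by
  classical
  rw [← List.toFinset_card_of_nodup h.nodup]
  refine Finset.card_le_card fun X hX => ?_
  rw [mem_nonemptySets, nonempty_iff_ne_empty]
  rintro rfl
  exact h.notMem_empty (List.mem_toFinset.1 hX)

theorem IsTour.length_pos {l : List (Set V)} (h : IsTour G a l) : 0 < l.length :=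
  List.length_pos_of_mem ((h.mem_iff univ).2 (isDominatingSet_univ G))

section Nonempty

variable [Finite V] [Nonempty V] [Finite W] [Nonempty W] {lA l : List (Set V)}
  {lB l' : List (Set W)}

theorem natCard_dominatingPairs_le (hlA : IsTour G a lA) (hlB : IsTour H b lB) :
    Nat.card (dominatingPairs G H) ≤
      (nonemptySets V).card * (nonemptySets W).card + lA.length + lB.length := by
  rw [← card_gridVertices]
  refine natCard_le_card_of_forall_mem fun ⟨X, Y⟩ hXY => ?_
  rw [mem_gridVertices, hlA.mem_iff, hlB.mem_iff, or_assoc]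
  exact mem_dominatingPairs_iff.1 hXY

theorem hasCycle_of_cons_le_gridVertices (hlA : IsTour G a lA) (hlB : IsTour H b lB)
    (hl : l.Sublist lA) (hl' : l'.Sublist lB) {o : Set V × Set W}
    (h : FlexPath (pairGraph G H) o o m s) (hs : o ::ₘ s ≤ gridVertices l l') (hmk : m < k)
    (hks : k ≤ s.card + 1) (hk : 3 ≤ k) :
    HasCycle ((pairGraph G H).induce (dominatingPairs G H)) k := by
  refine h.hasCycle (Multiset.nodup_of_le hs ?_) (fun ⟨X, Y⟩ hXY => ?_) hmk hks hk
  · exact nodup_gridVertices (hlA.nodup.sublist hl) (hlB.nodup.sublist hl')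
      fun h => hlA.notMem_empty (hl.subset h)
  · rw [mem_dominatingPairs_iff, ← hlA.mem_iff, ← hlB.mem_iff, ← or_assoc]
    exact (mem_gridVertices.1 (Multiset.mem_of_le hs hXY)).imp
      (Or.imp_right (And.imp_left (hl.subset ·))) (And.imp_right (hl'.subset ·))

end Nonempty

theorem grid_card_bound {p q k l : ℕ} (hp : 3 ≤ p) (hq : 7 ≤ q) (hk : k ≤ p) (hl : l ≤ q) :
    k + (2 * p + 2 * q - 6) + 1 ≤ p * q ∧ l + (2 * p + 2 * q - 6) ≤ p * q := by
  obtain ⟨p, rfl⟩ := Nat.exists_eq_add_of_le hp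
  obtain ⟨q, rfl⟩ := Nat.exists_eq_add_of_le hq
  have : (3 + p) * (7 + q) = 21 + 7 * p + 3 * q + p * q := by ring
  omega

theorem exists_hasCycle_grid [Finite V] [Nontrivial V] [Finite W] [Nonempty W]
    (hW : 3 ≤ Nat.card W) {lA : List (Set V)} {lB : List (Set W)} (hlA : IsTour G a lA)
    (hlB : IsTour H b lB) : ∃ c, ∀ {k : ℕ} {l : List (Set V)} {l' : List (Set W)}, 3 ≤ k →
      l.Sublist lA → l'.Sublist lB →
      FlexPath (pairGraph G H) (univ, {b}) (univ \ {a}, {b}) l.length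
        ↑(l.map (·, (∅ : Set W))) →
      FlexPath (pairGraph G H) ({c}, univ) ({c}, univ \ {b}) l'.length
        ↑(l'.map ((∅ : Set V), ·)) →
      pad (l.length + l'.length)
        (2 * (nonemptySets V).card + 2 * (nonemptySets W).card - 6) + 1 < k →
      k ≤ (nonemptySets V).card * (nonemptySets W).card + l.length + l'.length →
      HasCycle ((pairGraph G H).induce (dominatingPairs G H)) k := by
  obtain ⟨c, hgrid⟩ := exists_flexPath_grid hW G H a b
  refine ⟨c, fun hk hl hl' hA hB hmin hmax => ?_⟩
  obtain ⟨T, hT, heq⟩ := hgrid hA hB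
  refine hasCycle_of_cons_le_gridVertices hlA hlB hl hl' hT heq.le hmin ?_ hk
  rwa [← Multiset.card_cons, heq, ← gridVertices, card_gridVertices]

theorem isPancyclic_pairGraph_of_three_le [Finite V] [Nontrivial V] [Finite W]
    (hW : 3 ≤ Nat.card W) (hG : G.tarsGraph.IsPancyclic) (hH : H.tarsGraph.IsPancyclic) :
    ((pairGraph G H).induce (dominatingPairs G H)).IsPancyclic := by
  have : Nonempty W := Finite.card_pos_iff.1 (by omega)
  obtain ⟨a, lA, hlA⟩ := exists_isTour hG
  obtain ⟨b, lB, hlB⟩ := exists_isTour hH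
  obtain ⟨c, hasCycle⟩ := exists_hasCycle_grid hW hlA hlB
  intro k hk hk'
  have hcard := hk'.trans (natCard_dominatingPairs_le hlA hlB)
  have hA := hlA.flexPath (isTokenPage_left G H b)
  have hB := hlB.flexPath (isTokenPage_right G H c)
  have hA₀ := pairGraph_adj_left (G := G) (H := H) (Y := {b}) (Or.inl (tarAdj_univ_compl a))
  have hB₀ := pairGraph_adj_right (G := G) (H := H) (X := {c}) (Or.inl (tarAdj_univ_compl b))
  have hpos := hlA.length_pos
  have hgrid_card := grid_card_bound (three_le_card_nonemptySets (Finite.one_lt_card (α := V)))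
    (seven_le_card_nonemptySets hW) hlA.length_le_card_nonemptySets
    hlB.length_le_card_nonemptySets
  have pad_le (n : ℕ) := pad_le n (2 * (nonemptySets V).card + 2 * (nonemptySets W).card - 6)
  by_cases h₀ : k ≤ (nonemptySets V).card * (nonemptySets W).card
  · exact hasCycle hk (List.nil_sublist _) (List.nil_sublist _) (.of_adj hA₀) (.of_adj hB₀)
      (by simp only [pad, List.length_nil, add_zero, if_true]; omega) h₀
  by_cases h₁ : k ≤ (nonemptySets V).card * (nonemptySets W).card + lA.length
  · exact hasCycle hk (List.Sublist.refl _) (List.nil_sublist _) hA (.of_adj hB₀)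
      (by grw [pad_le, List.length_nil]; omega) h₁
  by_cases h₂ : k ≤ (nonemptySets V).card * (nonemptySets W).card + lB.length
  · exact hasCycle hk (List.nil_sublist _) (List.Sublist.refl _) (.of_adj hA₀) hB
      (by grw [pad_le, List.length_nil]; omega) h₂
  · exact hasCycle hk (List.Sublist.refl _) (List.Sublist.refl _) hA hB
      (by grw [pad_le]; omega) hcard

theorem exists_nonemptySets_eq [Finite V] (hV : Nat.card V = 2) (a : V) :
    ∃ c, univ \ {c} = {a} ∧ (nonemptySets V).val = {univ, univ \ {a}, univ \ {c}} := by
  have : Nontrivial V := Finite.one_lt_card_iff_nontrivial.1 (by omega)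
  obtain ⟨c, hca⟩ := exists_ne a
  have hnodup : ({univ, univ \ {a}, univ \ {c}} : Multiset (Set V)).Nodup := by
    have ne_univ (x : V) : univ \ {x} ≠ univ := fun h => (h.symm.subset (mem_univ x)).2 rfl
    have hne : univ \ {a} ≠ univ \ {c} := fun h => (h.symm.subset ⟨mem_univ a, hca.symm⟩).2 rfl
    simp [Multiset.insert_eq_cons, (ne_univ _).symm, hne]
  refine ⟨c, ?_, (Multiset.eq_of_le_of_card_le ((Multiset.le_iff_subset hnodup).2 ?_) ?_).symm⟩
  · exact (eq_of_subset_of_ncard_le (by simpa using hca.symm) (by simp [ncard_sdiff, hV])).symm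
  · intro X hX
    rw [Finset.mem_val, mem_nonemptySets]
    obtain rfl | rfl | rfl : X = univ ∨ X = univ \ {a} ∨ X = univ \ {c} := by simpa using hX
    exacts [univ_nonempty, ⟨c, mem_univ c, hca⟩, ⟨a, mem_univ a, hca.symm⟩]
  · have hcard := card_nonemptySets V
    rw [hV] at hcard
    change _ ≤ 3
    rw [Finset.card_val]
    omega

theorem gridVertices_eq [Finite V] [Finite W]
    (hV : (nonemptySets V).val = {univ, univ \ {a}, univ \ {c}})
    (hW : (nonemptySets W).val = {univ, univ \ {b}, univ \ {d}})
    (l : List (Set V)) (l' : List (Set W)) : gridVertices l l' =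
      (univ, univ \ {d}) ::ₘ
        ({(univ, univ), (univ \ {c}, univ), (univ, univ \ {b}), (univ \ {c}, univ \ {b}),
          (univ \ {a}, univ \ {b}), (univ \ {a}, univ)} +
        ((univ \ {a}, univ \ {d}) ::ₘ ↑(l.map (·, (∅ : Set W)))) +
        ((univ \ {c}, univ \ {d}) ::ₘ ↑(l'.map ((∅ : Set V), ·)))) := by
  rw [gridVertices, hV, hW]
  simp only [Multiset.insert_eq_cons, ← Multiset.singleton_add, Multiset.add_product,
    Multiset.product_add, Multiset.product_singleton]
  abel

theorem hasCycle_fan [Finite V] [Nonempty V] [Finite W] [Nonempty W] {lA : List (Set V)}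
    {lB : List (Set W)} (hlA : IsTour G a lA) (hlB : IsTour H b lB)
    (hV : (nonemptySets V).val = {univ, univ \ {a}, univ \ {c}})
    (hW : (nonemptySets W).val = {univ, univ \ {b}, univ \ {d}}) (hk : 3 ≤ k) (hk' : k ≤ 4) :
    HasCycle ((pairGraph G H).induce (dominatingPairs G H)) k := by
  refine hasCycle_of_cons_le_gridVertices hlA hlB (List.nil_sublist _) (List.nil_sublist _)
    (flexPath_fan c b d) ?_ (by omega) hk' hk
  rw [gridVertices_eq hV hW]
  refine Multiset.cons_le_cons _ (le_add_right (le_add_right ?_))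
  simp [Multiset.insert_eq_cons]

theorem flexPath_threeByThree_side (h : FlexPath (pairGraph G H) (univ, univ \ {d})
      (univ \ {a}, univ \ {d}) k s) :
    FlexPath (pairGraph G H) (univ \ {a}, univ) (univ, univ \ {d}) (k + 1)
      ((univ \ {a}, univ \ {d}) ::ₘ s) := by
  simpa using (FlexPath.of_adj (pairGraph_adj_right (Or.inl (tarAdj_univ_compl d)))).trans h.symm

theorem hasCycle_threeByThree [Finite V] [Nonempty V] [Finite W] [Nonempty W] {lA l : List (Set V)}
    {lB l' : List (Set W)} (hlA : IsTour G a lA) (hlB : IsTour H b lB) (hl : l.Sublist lA)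
    (hl' : l'.Sublist lB) (hV : (nonemptySets V).val = {univ, univ \ {a}, univ \ {c}})
    (hW : (nonemptySets W).val = {univ, univ \ {b}, univ \ {d}}) {i j : ℕ}
    (hA : FlexPath (pairGraph G H) (univ \ {a}, univ) (univ, univ \ {d}) i s)
    (hB : FlexPath (pairGraph G H) (univ \ {c}, univ) (univ \ {c}, univ \ {b}) j t)
    (hs : s ≤ (univ \ {a}, univ \ {d}) ::ₘ ↑(l.map (·, (∅ : Set W))))
    (ht : t ≤ (univ \ {c}, univ \ {d}) ::ₘ ↑(l'.map ((∅ : Set V), ·)))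
    (hmin : i + j + 4 < k) (hmax : k ≤ s.card + t.card + 7) (hk : 3 ≤ k) :
    HasCycle ((pairGraph G H).induce (dominatingPairs G H)) k := by
  refine hasCycle_of_cons_le_gridVertices hlA hlB hl hl' (flexPath_threeByThree hA hB) ?_ hmin
    (by simp only [Multiset.insert_eq_cons, Multiset.cons_add, Multiset.singleton_add,
      Multiset.card_cons, Multiset.card_add]; omega) hk
  rw [gridVertices_eq hV hW]
  exact Multiset.cons_le_cons _ (add_le_add (add_le_add le_rfl hs) ht)

theorem isPancyclic_pairGraph_of_card_eq_two [Finite V] [Finite W] (hV : Nat.card V = 2)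
    (hW : Nat.card W = 2) (hG : G.tarsGraph.IsPancyclic) (hH : H.tarsGraph.IsPancyclic) :
    ((pairGraph G H).induce (dominatingPairs G H)).IsPancyclic := by
  have : Nonempty V := Finite.card_pos_iff.1 (by omega)
  have : Nonempty W := Finite.card_pos_iff.1 (by omega)
  obtain ⟨a, lA, hlA⟩ := exists_isTour hG
  obtain ⟨b, lB, hlB⟩ := exists_isTour hH
  obtain ⟨c, hc, hVsets⟩ := exists_nonemptySets_eq hV a
  obtain ⟨d, hd, hWsets⟩ := exists_nonemptySets_eq hW b
  have rightPage := hc ▸ isTokenPage_right G H a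
  have hA := flexPath_threeByThree_side (hlA.flexPath (hd ▸ isTokenPage_left G H b))
  have hA₀ := FlexPath.triangle (pairGraph_slide_univ (G := G) (H := H) a d).symm
    (pairGraph_adj_right (Or.inl (tarAdj_univ_compl d)))
    (pairGraph_adj_left (Or.inl (tarAdj_univ_compl a).symm))
  have hB := (hlB.flexPath rightPage).cons_of_adj
    (pairGraph_adj_right (Or.inl (tarAdj_univ_compl d)))
    (hlB.flexPath_of_adj rightPage (rightPage.adj_compl d).symm)
  have hB₀ := FlexPath.of_adj (pairGraph_adj_right (G := G) (H := H) (X := univ \ {c})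
    (Or.inl (tarAdj_univ_compl b)))
  have hlA_le := hlA.length_le_card_nonemptySets
  have hlB_le := hlB.length_le_card_nonemptySets
  intro k hk hk'
  have hcard := hk'.trans (natCard_dominatingPairs_le hlA hlB)
  have hV3 : (nonemptySets V).card = 3 := by rw [Finset.card_def, hVsets]; rfl
  have hW3 : (nonemptySets W).card = 3 := by rw [Finset.card_def, hWsets]; rfl
  rw [hV3] at hlA_le hcard
  rw [hW3] at hlB_le hcard
  by_cases h₀ : k ≤ 4
  · exact hasCycle_fan hlA hlB hVsets hWsets hk h₀
  by_cases h₁ : k ≤ 8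
  · exact hasCycle_threeByThree hlA hlB (List.nil_sublist _) (List.nil_sublist _) hVsets hWsets
      hA₀ hB₀ le_rfl (Multiset.zero_le _) (by omega) (by simpa) hk
  by_cases h₂ : k ≤ 9 + lB.length
  · exact hasCycle_threeByThree hlA hlB (List.nil_sublist _) (List.Sublist.refl _) hVsets hWsets
      hA₀ hB le_rfl le_rfl (by omega)
      (by grind [Multiset.card_cons, Multiset.coe_card, Multiset.card_singleton]) hk
  · exact hasCycle_threeByThree hlA hlB (List.Sublist.refl _) (List.Sublist.refl _) hVsets hWsets
      hA hB le_rfl le_rfl (by omega)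
      (by grind [Multiset.card_cons, Multiset.coe_card]) hk

end Cycles

section Join

variable {V : Type u} {W : Type v} {G : SimpleGraph V} {H : SimpleGraph W}

theorem tarAdj_image {α β : Type*} {f : α → β} (hf : f.Injective) {X Y : Set α}
    (h : TARAdj X Y) : TARAdj (f '' X) (f '' Y) := by
  obtain ⟨w, rfl⟩ := tarAdj_iff_exists_toggle.1 h
  exact tarAdj_iff_exists_toggle.2 ⟨f w, by rw [image_symmDiff hf, image_singleton]⟩

theorem tsAdj_image {V' : Type*} {G' : SimpleGraph V'} (e : G ↪g G') {X Y : Set V}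
    (h : TSAdj G X Y) :
    TSAdj G' (e '' X) (e '' Y) := by
  obtain ⟨u, hu, v, ⟨hv, hv'⟩, huv, rfl⟩ := h
  refine ⟨e u, mem_image_of_mem _ hu, e v, ⟨mem_image_of_mem _ hv, ?_⟩, e.map_adj_iff.2 huv, ?_⟩
  · rwa [e.injective.mem_set_image]
  · rw [image_sdiff e.injective, image_union, image_singleton, image_singleton]

theorem tokenGraph_adj_image {V' : Type*} {G' : SimpleGraph V'} (e : G ↪g G') {X Y : Set V}
    (h : (tokenGraph G).Adj X Y) : (tokenGraph G').Adj (e '' X) (e '' Y) :=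
  h.imp (tarAdj_image e.injective) (tsAdj_image e)

theorem isDominatingSet_image {V' : Type*} {G' : SimpleGraph V'} (e : G ≃g G') {X : Set V}
    (hX : G.IsDominatingSet X) : G'.IsDominatingSet (e '' X) := by
  intro w
  obtain ⟨v, rfl⟩ := e.surjective w
  exact (hX v).imp (mem_image_of_mem e) fun ⟨x, hx, hxv⟩ =>
    ⟨e x, mem_image_of_mem e hx, e.map_adj_iff.2 hxv⟩

/-- The action of a graph isomorphism on the dominating sets by images. -/
def tarsIso {V' : Type*} {G' : SimpleGraph V'} (e : G ≃g G') : G.tarsGraph ≃g G'.tarsGraph where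
  toFun X := ⟨e '' X.1, isDominatingSet_image e X.2⟩
  invFun X := ⟨e.symm '' X.1, isDominatingSet_image e.symm X.2⟩
  left_inv X := Subtype.ext (e.toEquiv.symm_image_image X.1)
  right_inv X := Subtype.ext (e.toEquiv.image_symm_image X.1)
  map_rel_iff' {X Y} := by
    refine ⟨fun h => ?_, tokenGraph_adj_image e.toEmbedding⟩
    have := tokenGraph_adj_image e.symm.toEmbedding h
    exact (congrArg₂ (tokenGraph G).Adj (e.toEquiv.symm_image_image X.1)
      (e.toEquiv.symm_image_image Y.1)).mp this

/-- The join is commutative up to isomorphism. -/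
def joinComm (G : SimpleGraph V) (H : SimpleGraph W) : G.join H ≃g H.join G where
  toEquiv := Equiv.sumComm V W
  map_rel_iff' := by rintro (x | x) (y | y) <;> simp

/-- Joining with the graph without vertices changes nothing. -/
def joinEmpty [IsEmpty W] (G : SimpleGraph V) (H : SimpleGraph W) : G ≃g G.join H where
  toEquiv := (Equiv.sumEmpty V W).symm
  map_rel_iff' := by simp

/-- A graph with all edges between a set and its complement is the join of the two induced
subgraphs. -/
noncomputable def joinInduceCompl {K : Set V} (h : ∀ x ∈ K, ∀ y ∉ K, G.Adj x y) :
    (G.induce K).join (G.induce Kᶜ) ≃g G := by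
  classical
  exact
    { toEquiv := Equiv.Set.sumCompl K
      map_rel_iff' := by
        rintro (⟨a, ha⟩ | ⟨a, ha⟩) (⟨b, hb⟩ | ⟨b, hb⟩)
        · simp
        · simpa using h a ha b hb
        · simpa using (h b hb a ha).symm
        · simp }

theorem isPancyclic_tarsGraph_of_iso [Finite V] [Finite W] (e : G ≃g H)
    (h : G.tarsGraph.IsPancyclic) : H.tarsGraph.IsPancyclic :=
  isPancyclic_of_iso (tarsIso e) h

theorem isPancyclic_join_of_card_le [Finite V] [Finite W] (hVW : Nat.card V ≤ Nat.card W)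
    (hG : G.tarsGraph.IsPancyclic) (hH : H.tarsGraph.IsPancyclic) :
    (G.join H).tarsGraph.IsPancyclic := by
  rcases (show Nat.card V = 0 ∨ Nat.card V = 1 ∨ 2 ≤ Nat.card V by omega) with hV | hV | hV
  · have : IsEmpty V := Finite.card_eq_zero_iff.1 hV
    exact isPancyclic_tarsGraph_of_iso ((joinEmpty H G).trans (joinComm H G)) hH
  · have : Nonempty W := Finite.card_pos_iff.1 (by omega)
    have : Subsingleton V := Finite.card_le_one_iff_subsingleton.1 hV.le
    obtain ⟨v⟩ : Nonempty V := Finite.card_pos_iff.1 (by omega)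
    exact isPancyclic_tarsGraph_of_iso (joinComm H G)
      (isPancyclic_join_of_pairGraph (isPancyclic_pairGraph_of_subsingleton v hH))
  · have : Nontrivial V := Finite.one_lt_card_iff_nontrivial.1 hV
    refine isPancyclic_join_of_pairGraph ?_
    by_cases hW : 3 ≤ Nat.card W
    · exact isPancyclic_pairGraph_of_three_le hW hG hH
    · exact isPancyclic_pairGraph_of_card_eq_two (by omega) (by omega) hG hH

theorem isPancyclic_join [Finite V] [Finite W] (hG : G.tarsGraph.IsPancyclic)
    (hH : H.tarsGraph.IsPancyclic) : (G.join H).tarsGraph.IsPancyclic := by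
  rcases le_total (Nat.card V) (Nat.card W) with h | h
  · exact isPancyclic_join_of_card_le h hG hH
  · exact isPancyclic_tarsGraph_of_iso (joinComm H G) (isPancyclic_join_of_card_le h hH hG)

theorem isPancyclic_tarsGraph_bot [Finite V] : (⊥ : SimpleGraph V).tarsGraph.IsPancyclic := by
  have eq_univ (X : {X // (⊥ : SimpleGraph V).IsDominatingSet X}) : X.1 = univ :=
    eq_univ_of_forall fun w => (X.2 w).resolve_right (by simp)
  have hsub : Subsingleton {X // (⊥ : SimpleGraph V).IsDominatingSet X} :=
    ⟨fun X Y => Subtype.ext ((eq_univ X).trans (eq_univ Y).symm)⟩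
  have := Finite.card_le_one_iff_subsingleton.2 hsub
  intro k hk hk'
  omega

theorem isPancyclic_of_isCompleteMultipartite [Finite V] (h : G.IsCompleteMultipartite) :
    G.tarsGraph.IsPancyclic := by
  induction hn : Nat.card V using Nat.strong_induction_on generalizing V with
  | _ n ih =>
    rcases isEmpty_or_nonempty V with hV | ⟨⟨v⟩⟩
    · rw [Subsingleton.elim G ⊥]
      exact isPancyclic_tarsGraph_bot
    have adj_of_part : ∀ x ∈ {x | ¬ G.Adj v x}, ∀ y ∉ {x | ¬ G.Adj v x}, G.Adj x y :=
      fun x hx y hy => by_contra fun hxy => hy (h.trans v x y hx hxy)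
    have part_eq_bot : G.induce {x | ¬ G.Adj v x} = ⊥ := by
      ext ⟨x, hx⟩ ⟨y, hy⟩
      simp only [comap_adj, Function.Embedding.subtype_apply, bot_adj, iff_false]
      exact h.trans x v y (fun hxv => hx hxv.symm) hy
    refine isPancyclic_tarsGraph_of_iso (joinInduceCompl adj_of_part) (isPancyclic_join ?_ ?_)
    · rw [part_eq_bot]
      exact isPancyclic_tarsGraph_bot
    · exact ih _ (hn ▸ Finite.card_subtype_lt (x := v) (by simp)) h.induce rfl

theorem isPancyclic_of_isCompleteSplit [Finite V] (h : G.IsCompleteSplit) :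
    G.tarsGraph.IsPancyclic := by
  obtain ⟨K, hK, hI, hKI⟩ := h
  have compl_eq_bot : G.induce Kᶜ = ⊥ := by
    ext ⟨x, hx⟩ ⟨y, hy⟩
    simp only [comap_adj, Function.Embedding.subtype_apply, bot_adj, iff_false]
    exact fun hxy => hI hx hy hxy.ne hxy
  refine isPancyclic_tarsGraph_of_iso (joinInduceCompl hKI) (isPancyclic_join ?_ ?_)
  · rw [induce_eq_top.2 hK]
    exact isPancyclic_of_isCompleteMultipartite ⟨fun a b c hab hbc => by simp_all⟩
  · rw [compl_eq_bot]
    exact isPancyclic_tarsGraph_bot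

end Join

end TARS

theorem mainTheorem2 :
    (∀ (V : Type u) (W : Type v) [Finite V] [Finite W] (G : SimpleGraph V) (H : SimpleGraph W),
      G.tarsGraph.IsPancyclic → H.tarsGraph.IsPancyclic → (G.join H).tarsGraph.IsPancyclic) ∧
    (∀ (V : Type u) [Finite V] (G : SimpleGraph V),
      G.IsCompleteMultipartite → G.tarsGraph.IsPancyclic) ∧
    (∀ (V : Type u) [Finite V] (G : SimpleGraph V),
      G.IsCompleteSplit → G.tarsGraph.IsPancyclic) :=
  ⟨fun _ _ _ _ _ _ hG hH => TARS.isPancyclic_join hG hH,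
    fun _ _ _ h => TARS.isPancyclic_of_isCompleteMultipartite h,
    fun _ _ _ h => TARS.isPancyclic_of_isCompleteSplit h⟩
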